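/- Consider AdWords with a set of advertisers $A$, where $a\in A$ has budget $B_a>0$, and impressions $1,2,3,\dots$ arriving one at a time, where $a$ bids $b_{ai}\in[0,B_a]$ for impression $i$. **Rounds.** Each round is either deterministic (impression $i$ is assigned to one advertiser) or randomized ($i$ is semi-assigned to two different advertisers, one of which is to be selected). The kinds of the rounds and the advertisers involved are oblivious, i.e. they do not depend on the selections. Subsets are chosen by panoramic interval-level assignment: regard $[0,B_a)$ as a circle, with a marker $y^*_a$ initially at $0$, and let $D_a\subseteq[0,B_a)$ be the set of points assigned in earlier deterministic rounds. When impression $i$ is assigned or semi-assigned to $a$, it gets the subset $Y_{ai}=[y^*_a,z)\setminus D_a$ (a circular interval), where $z$ is the first point such that $Y_{ai}$ has measure $b_{ai}$, or $Y_{ai}=[0,B_a)\setminus D_a$ and $z=y_a^*$ if $[0,B_a)\setminus D_a$ has measure less than $b_{ai}$; then $y^*_a$ is moved to $z$. **PanOCS.** A PanOCS is a randomized online algorithm which receives, in each randomized round, the pair of advertiser-subset combinations $(a,Y_{ai}),(a',Y_{a'i})$, and immediately and irrevocably selects one of them, each with marginal probability $\frac12$. A point $y\in[0,B_a)$ is assigned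 if it lies in $Y_{ai}$ for a deterministic round $i$ of $a$, or for a randomized round $i$ in which $a$ is selected. Let $x_a(y)$ be the probability that $y$ is assigned in the rounds so far. Let $k_a(y)$ be the number of randomized rounds so far in which $i$ is semi-assigned to $a$ and a subset $Y_{ai}$ containing $y$, and let $k_a(y)=\infty$ if $y$ has been assigned in a deterministic round. For $0\le\gamma\le1$, the algorithm is a $\gamma$-PanOCS if at any time, for every advertiser $a$ and every $y\in[0,B_a)$, $$x_a(y)\ \ge\ 1-2^{-k_a(y)}(1-\gamma)^{\max\{k_a(y)-1,0\}}$$ (the right-hand side being $1$ for $k_a(y)=\infty$). **Sender/receiver algorithm with parameter $p$.** The dependence graph has a node for each randomized round, and an arc $(i,i')_a$ for $i<i'$ if there is a point $y\in Y_{ai}\cap Y_{ai'}$, where $i,i'$ are semi-assigned to $a$, such that no round strictly between $i$ and $i'$ is semi-assigned to $a$ and a subset containing $y$. Each node is independently a sender with probability $p$ and a receiver otherwise. A sender selects with a fresh fair bit, and picks, each with probability $\frac14$, the first or the second out-arc with respect to one of its two advertisers. A receiver $i'$ checks whether senders have picked some of its in-arcs. If so, it chooses one such in-arc $(i,i')_a$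 uniformly at random, and selects $a$ if and only if $a$ was not selected in round $i$; otherwise it selects with a fresh fair bit. **Theorem.** If all nonzero bids are large, i.e. $b_{ai}=0$ or $\frac12B_a\le b_{ai}\le B_a$ for all $a$ and $i$, then there is a $0.05144$-PanOCS; namely, the sender/receiver algorithm with sender probability $p=\frac49$ is a $0.05144$-PanOCS. -/

import Mathlib

open MeasureTheory ProbabilityTheory

/-- A combination of an advertiser and a subset of its interval `[0, B a)`. -/
structure Combo (A : Type*) where
  adv : A
  pts : Set ℝ

/-- A pair of advertiser-subset combinations, indexed by `Bool`. -/
abbrev ComboPair (A : Type*) := Bool → Combo A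

/-! ### Randomized online algorithms selecting one combination from each pair -/

/-- A randomized online selection algorithm. The input is a stream of rounds: `some c` is a round
which brings the pair of combinations `c`, and `none` is a round in which nothing is to be
selected. Independently in each round a fresh seed is drawn from the probability measure `law`.
In a round `t` with a pair `c`, the algorithm selects the combination `c (select P ω t)`.
The field `online` says that the selection in round `t` depends only on the pairs and seeds of
the rounds up to `t`. -/
structure OnlineSelector (A : Type*) where
  Seed : Type
  [mSeed : MeasurableSpace Seed]
  law : Measure Seed
  [isProb : IsProbabilityMeasure law]
  select : (ℕ → Option (ComboPair A)) → (ℕ → Seed) → ℕ → Bool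
  online : ∀ (P P' : ℕ → Option (ComboPair A)) (ω ω' : ℕ → Seed) (t : ℕ),
    (∀ s ≤ t, P s = P' s) → (∀ s ≤ t, ω s = ω' s) → select P ω t = select P' ω' t
  measurable : ∀ (P : ℕ → Option (ComboPair A)) (t : ℕ), Measurable fun ω => select P ω t

attribute [instance] OnlineSelector.mSeed OnlineSelector.isProb

/-- The joint law of the independent seeds of all rounds. -/
noncomputable def OnlineSelector.prob {A : Type*} (alg : OnlineSelector A) :
    Measure (ℕ → alg.Seed) :=
  Measure.infinitePi fun _ => alg.law

/-! ### AdWords instances in the panorama view -/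

/-- The kind of a round: the impression is assigned to an advertiser deterministically, or it is
semi-assigned to a pair of advertisers. -/
inductive Decision (A : Type*) where
  | deterministic (a : A)
  | randomized (p : Bool → A)

/-- The advertisers that the impression is assigned or semi-assigned to. -/
def Decision.Chooses {A : Type*} : Decision A → A → Prop
  | .deterministic a', a => a = a'
  | .randomized p, a => a = p false ∨ a = p true

/-- An impression, with the bids of all advertisers and the kind of the round. Since the
kind is part of the input stream, it does not depend on the random seeds (obliviousness). -/
structure Impression (A : Type*) where
  bid : A → ℝ
  decision : Decision A

/-- The distance from `y` to `z` when moving forward on the circle obtained from `[0, β)` by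
gluing its endpoints. -/
noncomputable def forwardDist (β y z : ℝ) : ℝ :=
  if y ≤ z then z - y else z - y + β

/-- The left-closed, right-open arc of length `ℓ` of the circle `[0, β)` that starts at `y`. -/
def circArc (β y ℓ : ℝ) : Set ℝ :=
  {z | z ∈ Set.Ico 0 β ∧ forwardDist β y z < ℓ}

/-- The least length of an arc from `y` which has measure `b` outside of `D`; it is the length
`β` of the whole circle when the complement of `D` has a measure less than `b`. -/
noncomputable def scanLength (β y b : ℝ) (D : Set ℝ) : ℝ :=
  sInf ({ℓ | ℓ ∈ Set.Icc 0 β ∧ ENNReal.ofReal b ≤ volume (circArc β y ℓ \ D)} ∪ {β})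

/-- The subset of `[0, β)` found by scanning the circle from `y` and skipping `D`, until
measure `b` has been collected or the whole circle has been scanned. -/
noncomputable def scanSet (β y b : ℝ) (D : Set ℝ) : Set ℝ :=
  circArc β y (scanLength β y b D) \ D

/-- The point at which this scan ends. -/
noncomputable def scanEnd (β y b : ℝ) (D : Set ℝ) : ℝ :=
  if y + scanLength β y b D < β then y + scanLength β y b D else y + scanLength β y b D - β

/-- For each advertiser, the start of the next subset, and the set of points that have been
assigned in deterministic rounds. -/
structure PanState (A : Type*) where
  start : A → ℝ
  fixed : A → Set ℝ

/-- The subset of `[0, B a)` offered to the impression `i` by advertiser `a`. -/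
noncomputable def PanState.subset {A : Type*} (B : A → ℝ) (σ : PanState A) (i : Impression A)
    (a : A) : Set ℝ :=
  scanSet (B a) (σ.start a) (i.bid a) (σ.fixed a)

open scoped Classical in
/-- The update of the state by the impression `i`. -/
noncomputable def PanState.next {A : Type*} (B : A → ℝ) (σ : PanState A) (i : Impression A) :
    PanState A where
  start a :=
    if i.decision.Chooses a then scanEnd (B a) (σ.start a) (i.bid a) (σ.fixed a) else σ.start a
  fixed a :=
    if i.decision = .deterministic a then σ.fixed a ∪ σ.subset B i a else σ.fixed a

/-- The state before round `t` of the panoramic interval-level assignment. -/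
noncomputable def panState {A : Type*} (B : A → ℝ) (I : ℕ → Impression A) : ℕ → PanState A
  | 0 => ⟨fun _ => 0, fun _ => ∅⟩
  | t + 1 => (panState B I t).next B (I t)

/-- The subset `Y` of `[0, B a)` for impression `t` and advertiser `a`. -/
noncomputable def panSubset {A : Type*} (B : A → ℝ) (I : ℕ → Impression A) (t : ℕ) (a : A) :
    Set ℝ :=
  (panState B I t).subset B (I t) a

/-- The stream of pairs of advertiser-subset combinations in the randomized rounds. -/
noncomputable def panPairs {A : Type*} (B : A → ℝ) (I : ℕ → Impression A) (t : ℕ) :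
    Option (ComboPair A) :=
  match (I t).decision with
  | .deterministic _ => none
  | .randomized p => some fun s => ⟨p s, panSubset B I t (p s)⟩

/-- In round `t`, an impression is semi-assigned to `a` and a subset that contains `y`. -/
def SemiAssigned {A : Type*} (P : ℕ → Option (ComboPair A)) (t : ℕ) (a : A) (y : ℝ) : Prop :=
  ∃ c, P t = some c ∧ ∃ s : Bool, (c s).adv = a ∧ y ∈ (c s).pts

/-- In round `t`, the point `y` of advertiser `a` is assigned deterministically. -/
def DetAssigned {A : Type*} (B : A → ℝ) (I : ℕ → Impression A) (t : ℕ) (a : A) (y : ℝ) : Prop :=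
  (I t).decision = .deterministic a ∧ y ∈ panSubset B I t a

open scoped Classical in
/-- The number of times that the point `y` of advertiser `a` is semi-assigned in the first `n`
rounds; it is infinite if `y` is assigned in a deterministic round. -/
noncomputable def semiCount {A : Type*} (B : A → ℝ) (I : ℕ → Impression A) (n : ℕ) (a : A)
    (y : ℝ) : ℕ∞ :=
  if ∃ t < n, DetAssigned B I t a y then ⊤
  else (((Finset.range n).filter fun t => SemiAssigned (panPairs B I) t a y).card : ℕ∞)

/-- The event that the point `y` of advertiser `a` is assigned in the first `n` rounds, either in
a deterministic round or because the combination selected in a randomized round contains it. -/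
def assignedEvent {A : Type*} (B : A → ℝ) (alg : OnlineSelector A) (I : ℕ → Impression A)
    (n : ℕ) (a : A) (y : ℝ) : Set (ℕ → alg.Seed) :=
  {ω | ∃ t < n, DetAssigned B I t a y ∨
    ∃ c, panPairs B I t = some c ∧
      (c (alg.select (panPairs B I) ω t)).adv = a ∧
      y ∈ (c (alg.select (panPairs B I) ω t)).pts}

/-- The number `1 - 2^(-k) (1 - γ)^max(k - 1, 0)`, which is `1` for `k = ∞`. -/
noncomputable def panBound (γ : ℝ) : ℕ∞ → ℝ
  | ⊤ => 1
  | (k : ℕ) => 1 - (1 / 2) ^ k * (1 - γ) ^ (k - 1)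

/-- Bids are nonnegative and at most the budgets, and the two advertisers in each randomized
round are different. -/
structure ValidInstance {A : Type*} (B : A → ℝ) (I : ℕ → Impression A) : Prop where
  bid_nonneg : ∀ t a, 0 ≤ (I t).bid a
  bid_le : ∀ t a, (I t).bid a ≤ B a
  distinct : ∀ t p, (I t).decision = .randomized p → p false ≠ p true

/-- All nonzero bids are at least half of the budget. -/
def LargeBids {A : Type*} (B : A → ℝ) (I : ℕ → Impression A) : Prop :=
  ∀ t a, (I t).bid a = 0 ∨ B a / 2 ≤ (I t).bid a

/-- The algorithm is a `γ`-PanOCS on the instances with property `Q`: in each randomized round it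
selects each of the two combinations with probability one half, and at any time `n` each point of
each advertiser has been assigned with the required probability. -/
def IsPanOCS {A : Type*} (B : A → ℝ) (Q : (ℕ → Impression A) → Prop) (γ : ℝ)
    (alg : OnlineSelector A) : Prop :=
  0 ≤ γ ∧ γ ≤ 1 ∧ ∀ I : ℕ → Impression A, ValidInstance B I → Q I →
    (∀ t, (panPairs B I t).isSome →
      ∀ s : Bool, alg.prob.real {ω | alg.select (panPairs B I) ω t = s} = 1 / 2) ∧
    ∀ (n : ℕ) (a : A), ∀ y ∈ Set.Ico 0 (B a),
      panBound γ (semiCount B I n a y) ≤ alg.prob.real (assignedEvent B alg I n a y)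

/-! ### The sender/receiver algorithm on the dependence graph -/

namespace SenderReceiver

/-- The random choices of a node: whether it is a sender; the out-arc that it picks if it is a
sender (a side of its pair, and the first or the second out-arc with respect to the advertiser on
that side, for `false` and `true`); a fresh random bit; and a number that a receiver uses to
pick one of its candidate in-arcs. For large bids there are at most four of these; as `12` is
divisible by `1, 2, 3, 4`, the residue of a uniform element of `Fin 12` is a uniform choice. -/
abbrev Seed := Bool × (Bool × Bool) × Bool × Fin 12

/-- The node is a sender with probability `p`, and everything else is uniform and independent. -/
noncomputable def law (p : unitInterval) : Measure Seed :=
  (bernoulliMeasure true false p).prod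
    (PMF.uniformOfFintype ((Bool × Bool) × Bool × Fin 12)).toMeasure

instance (p : unitInterval) : IsProbabilityMeasure (law p) := by
  unfold law
  infer_instance

def isSender (r : Seed) : Bool := r.1
def outSide (r : Seed) : Bool := r.2.1.1
def outSecond (r : Seed) : Bool := r.2.1.2
def bit (r : Seed) : Bool := r.2.2.1
def tie (r : Seed) : ℕ := r.2.2.2

variable {A : Type*}

/-- The arcs `(s, t)` with respect to `a` of the ex-ante dependence graph: a common point of the
two subsets of `a` is not semi-assigned between the two rounds. -/
def Arc (P : ℕ → Option (ComboPair A)) (a : A) (s t : ℕ) : Prop :=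
  s < t ∧ ∃ y, SemiAssigned P s a y ∧ SemiAssigned P t a y ∧
    ∀ u, s < u → u < t → ¬ SemiAssigned P u a y

open scoped Classical in
/-- The number of out-arcs of `s` with respect to `a` which precede the arc `(s, t)`. -/
noncomputable def outIndex (P : ℕ → Option (ComboPair A)) (a : A) (s t : ℕ) : ℕ :=
  ((Finset.Ioo s t).filter fun u => Arc P a s u).card

/-- The node `s` is a sender which picks its out-arc `(s, t)` with respect to `a`. -/
def Picks (P : ℕ → Option (ComboPair A)) (ω : ℕ → Seed) (a : A) (s t : ℕ) : Prop :=
  Arc P a s t ∧ isSender (ω s) = true ∧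
    (∃ c, P s = some c ∧ (c (outSide (ω s))).adv = a) ∧
    outIndex P a s t = if outSecond (ω s) = true then 1 else 0

open scoped Classical in
/-- The in-arcs of `t` that are picked by senders. The entry `(s, i)` is the arc `(s, t)` with
respect to the advertiser on side `i` of the pair of `t`. -/
noncomputable def candidates (P : ℕ → Option (ComboPair A)) (ω : ℕ → Seed) (t : ℕ) :
    List (ℕ × Bool) :=
  ((List.range t).product [false, true]).filter fun q =>
    ∃ c, P t = some c ∧ Picks P ω (c q.2).adv q.1 t

open scoped Classical in
/-- A sender selects with its fresh bit. A receiver picks a candidate `(s, i)` uniformly, and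
selects the advertiser on its side `i` if and only if the sender `s`, who uses its own fresh
bit, does not select the same advertiser. A receiver without candidates selects with its
fresh bit. -/
noncomputable def select (P : ℕ → Option (ComboPair A)) (ω : ℕ → Seed) (t : ℕ) : Bool :=
  if isSender (ω t) = true then bit (ω t)
  else match (candidates P ω t)[tie (ω t) % (candidates P ω t).length]? with
    | none => bit (ω t)
    | some (s, i) =>
      if ∃ c c', P t = some c ∧ P s = some c' ∧ (c' (bit (ω s))).adv = (c i).adv then !i else i

theorem semiAssigned_congr {P P' : ℕ → Option (ComboPair A)} {t : ℕ} (h : P t = P' t) (a : A)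
    (y : ℝ) : SemiAssigned P t a y ↔ SemiAssigned P' t a y := by
  unfold SemiAssigned
  rw [h]

theorem arc_congr {P P' : ℕ → Option (ComboPair A)} {t : ℕ} (h : ∀ s ≤ t, P s = P' s) (a : A)
    (s : ℕ) : Arc P a s t ↔ Arc P' a s t := by
  unfold Arc
  refine and_congr_right fun hst => exists_congr fun y => ?_
  rw [semiAssigned_congr (h s hst.le), semiAssigned_congr (h t le_rfl)]
  refine and_congr_right fun _ => and_congr_right fun _ => ?_
  refine forall_congr' fun u => imp_congr_right fun _ => imp_congr_right fun hu => ?_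
  rw [semiAssigned_congr (h u hu.le)]

theorem picks_congr {P P' : ℕ → Option (ComboPair A)} {ω ω' : ℕ → Seed} {t : ℕ}
    (h : ∀ s ≤ t, P s = P' s) (h' : ∀ s ≤ t, ω s = ω' s) (a : A) (s : ℕ) :
    Picks P ω a s t ↔ Picks P' ω' a s t := by
  unfold Picks
  rw [arc_congr h]
  refine and_congr_right fun hst => ?_
  have hs : s ≤ t := hst.1.le
  have ho : outIndex P a s t = outIndex P' a s t := by
    classical
    unfold outIndex
    refine congrArg Finset.card (Finset.filter_congr fun u hu => ?_)
    exact arc_congr (fun v hv => h v (hv.trans (Finset.mem_Ioo.1 hu).2.le)) a s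
  rw [h s hs, h' s hs, ho]

theorem candidates_congr {P P' : ℕ → Option (ComboPair A)} {ω ω' : ℕ → Seed} {t : ℕ}
    (h : ∀ s ≤ t, P s = P' s) (h' : ∀ s ≤ t, ω s = ω' s) :
    candidates P ω t = candidates P' ω' t := by
  classical
  unfold candidates
  refine List.filter_congr fun q _ => ?_
  rw [decide_eq_decide, h t le_rfl]
  exact exists_congr fun c => and_congr_right fun _ => picks_congr h h' _ _

theorem lt_of_mem_candidates {P : ℕ → Option (ComboPair A)} {ω : ℕ → Seed} {t : ℕ}
    {q : ℕ × Bool} (h : q ∈ candidates P ω t) : q.1 < t := by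
  unfold candidates at h
  have h2 := (List.mem_filter.1 h).2
  simp only [decide_eq_true_eq] at h2
  obtain ⟨c, -, hc⟩ := h2
  exact hc.1.1

theorem select_online (P P' : ℕ → Option (ComboPair A)) (ω ω' : ℕ → Seed) (t : ℕ)
    (h : ∀ s ≤ t, P s = P' s) (h' : ∀ s ≤ t, ω s = ω' s) :
    select P ω t = select P' ω' t := by
  unfold select
  rw [candidates_congr h h', h' t le_rfl, h t le_rfl]
  split_ifs with hs
  · rfl
  · rcases hq : (candidates P' ω' t)[tie (ω' t) % (candidates P' ω' t).length]? with _ | ⟨s, i⟩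
    · rfl
    · have hlt : s < t := lt_of_mem_candidates (List.mem_of_getElem? hq)
      dsimp only
      rw [h s hlt.le, h' s hlt.le]

theorem measurable_select (P : ℕ → Option (ComboPair A)) (t : ℕ) :
    Measurable fun ω : ℕ → Seed => select P ω t := by
  classical
  let ext : (Fin (t + 1) → Seed) → ℕ → Seed := fun r s =>
    if hs : s < t + 1 then r ⟨s, hs⟩ else (false, (false, false), false, 0)
  have hfac : (fun ω : ℕ → Seed => select P ω t) =
      (fun r => select P (ext r) t) ∘ fun (ω : ℕ → Seed) (j : Fin (t + 1)) => ω j := by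
    funext ω
    refine select_online P P ω _ t (fun _ _ => rfl) fun s hs => ?_
    simp only [ext, dif_pos (Nat.lt_succ_of_le hs)]
  rw [hfac]
  refine Measurable.comp (Measurable.of_discrete) ?_
  exact measurable_pi_lambda _ fun j => measurable_pi_apply _

end SenderReceiver

/-- The sender/receiver algorithm with sender probability `p`. -/
noncomputable def senderReceiver (A : Type*) (p : unitInterval) : OnlineSelector A where
  Seed := SenderReceiver.Seed
  law := SenderReceiver.law p
  select := SenderReceiver.select
  online := SenderReceiver.select_online
  measurable := SenderReceiver.measurable_select

/-! Fix a point `y` of `a` that is not assigned deterministically, and let `u 0 < ... < u m` be the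
rounds in which it is semi-assigned; consecutive ones are joined by arcs. If one round of this chain
takes its selection from another, one of the two selects `a` (`select_of_source_eq`). Otherwise the
selections are decided by different fresh bits, since a sender picks a single arc (`source_injOn`),
and `a` is missed with probability exactly 2^-(m+1) (`bitExp_eq`). It remains to show that no arc of
the chain is realized with probability at most λ^m, where λ = 461/486.

Large bids make the graph sparse. Two consecutive nonzero bids for `a` cover everything outside the
deterministically assigned part, so at most one semi-assignment of a nonempty subset of `a` lies
strictly between the ends of an arc. Hence a node has at most two in-arcs and two out-arcs per
advertiser: each arc is picked with probability 4/9 · 1/4 = 1/9 and has at most three competitors at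
its head. When R of them are present, the arc loses the draw with probability R/(R+1), which is at
most R/2 for every integer R ≥ 0 except that it is trivially 0 for R = 0. A single arc is thus
realized with probability at least 1/9 · 5/9 · (1 - 3 · 1/9 · 1/2) = 25/486 = 1 - λ.

The arcs are dependent: neighbours share a node, and a node of the chain may be the source of a
competitor of another arc. Let q_m be the expectation of the product of the `missFactor`s, and a_m
the part of it in which `u m` is a receiver. Splitting by the states of the last nodes gives q_(m+1)
= a_(m+1) + (4/9) q_m and a_(m+1) ≤ (5/9) (a_m + (1/3) q_(m-1) + (1/54) b), where b bounds q_(m-1)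
conditioned on the presence of a competitor. Such conditioning disables at most the two arcs at one
node of the chain, at the cost of a factor 6/5. The bounds q_m ≤ λ^m and a_m ≤ (245/461) λ^m then
reproduce themselves (`coarseExp_missProd_le_aux`). -/

/-! ### Scanning the circle. -/

theorem volume_circArc_le {β y ℓ : ℝ} (hy : y ∈ Set.Ico 0 β) (hℓ : ℓ ∈ Set.Icc 0 β) :
    volume (circArc β y ℓ) ≤ ENNReal.ofReal ℓ := by
  obtain ⟨h0, h1⟩ := hy
  obtain ⟨h2, h3⟩ := hℓ
  -- The arc is cut at the gluing point `0`; the second piece is empty when there is no wrap-around.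
  have hsub : circArc β y ℓ ⊆ Set.Ico y (min (y + ℓ) β) ∪ Set.Ico 0 (y + ℓ - β) := by
    rintro z ⟨⟨hz0, hz1⟩, hz⟩
    unfold forwardDist at hz
    split_ifs at hz with h
    · left
      exact ⟨h, lt_min (by linarith) hz1⟩
    · right
      exact ⟨hz0, by linarith⟩
  refine (measure_mono hsub).trans ((measure_union_le _ _).trans ?_)
  rw [Real.volume_Ico, Real.volume_Ico]
  rcases le_total (y + ℓ) β with h | h
  · rw [min_eq_left h, ENNReal.ofReal_of_nonpos (by linarith : y + ℓ - β - 0 ≤ 0), add_zero]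
    exact ENNReal.ofReal_le_ofReal (by linarith)
  · rw [min_eq_right h, ← ENNReal.ofReal_add (by linarith) (by linarith)]
    exact ENNReal.ofReal_le_ofReal (by linarith)

theorem scanLength_mem {β y b : ℝ} {D : Set ℝ} (hβ : 0 ≤ β) : scanLength β y b D ∈ Set.Icc 0 β := by
  unfold scanLength
  constructor
  · refine Real.sInf_nonneg ?_
    rintro ℓ (h | h)
    · exact h.1.1
    · rw [Set.mem_singleton_iff.1 h]
      exact hβ
  · refine csInf_le ⟨0, ?_⟩ (Or.inr rfl)
    rintro ℓ (h | h)
    · exact h.1.1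
    · rw [Set.mem_singleton_iff.1 h]
      exact hβ

/-- An arc has measure at most its length, and removing `D` only decreases it. So at least half of
the circle is traversed by a large bid, however much is skipped. -/
theorem le_scanLength {β y b : ℝ} {D : Set ℝ} (hy : y ∈ Set.Ico 0 β) (hb : b ≤ β) :
    b ≤ scanLength β y b D := by
  unfold scanLength
  refine le_csInf ⟨β, Or.inr rfl⟩ ?_
  rintro ℓ (⟨h, hv⟩ | h)
  · have := hv.trans ((measure_mono Set.sdiff_subset).trans (volume_circArc_le hy h))
    exact (ENNReal.ofReal_le_ofReal_iff h.1).1 this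
  · rw [Set.mem_singleton_iff.1 h]
    exact hb

theorem scanLength_zero {β y : ℝ} {D : Set ℝ} (hβ : 0 ≤ β) : scanLength β y 0 D = 0 := by
  refine le_antisymm ?_ (scanLength_mem hβ).1
  unfold scanLength
  refine csInf_le ⟨0, ?_⟩ (Or.inl ⟨⟨le_rfl, hβ⟩, by simp⟩)
  rintro ℓ (h | h)
  · exact h.1.1
  · rw [Set.mem_singleton_iff.1 h]
    exact hβ

theorem scanEnd_mem {β y b : ℝ} {D : Set ℝ} (hy : y ∈ Set.Ico 0 β) :
    scanEnd β y b D ∈ Set.Ico 0 β := by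
  obtain ⟨h0, h1⟩ := hy
  obtain ⟨h2, h3⟩ := scanLength_mem (y := y) (b := b) (D := D) (h0.trans h1.le)
  unfold scanEnd
  split_ifs with h
  · exact ⟨by linarith, h⟩
  · exact ⟨by linarith, by linarith⟩

theorem scanEnd_zero {β y : ℝ} {D : Set ℝ} (hy : y ∈ Set.Ico 0 β) : scanEnd β y 0 D = y := by
  unfold scanEnd
  rw [scanLength_zero (hy.1.trans hy.2.le), add_zero, if_pos hy.2]

theorem scanSet_zero {β y : ℝ} {D : Set ℝ} (hy : y ∈ Set.Ico 0 β) : scanSet β y 0 D = ∅ := by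
  unfold scanSet
  rw [scanLength_zero (hy.1.trans hy.2.le)]
  refine Set.eq_empty_of_forall_notMem ?_
  rintro z ⟨⟨⟨hz0, hz1⟩, hz⟩, -⟩
  unfold forwardDist at hz
  split_ifs at hz <;> linarith [hy.1, hy.2]

/-- Two consecutive scans, each of at least half of the circle, cover the circle. -/
theorem mem_scanSet_or {β y b b' : ℝ} {D D' : Set ℝ} (hy : y ∈ Set.Ico 0 β) (hb : β / 2 ≤ b)
    (hbβ : b ≤ β) (hb' : β / 2 ≤ b') (hbβ' : b' ≤ β) {z : ℝ} (hz : z ∈ Set.Ico 0 β)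
    (hD : z ∉ D) (hD' : z ∉ D') :
    z ∈ scanSet β y b D ∨ z ∈ scanSet β (scanEnd β y b D) b' D' := by
  have h1 := le_scanLength (D := D) hy hbβ
  have h2 := le_scanLength (D := D') (scanEnd_mem (b := b) (D := D) hy) hbβ'
  by_contra! hcon
  have hn1 : ¬ forwardDist β y z < scanLength β y b D := fun h => hcon.1 ⟨⟨hz, h⟩, hD⟩
  have hn2 : ¬ forwardDist β (scanEnd β y b D) z < scanLength β (scanEnd β y b D) b' D' :=
    fun h => hcon.2 ⟨⟨hz, h⟩, hD'⟩
  obtain ⟨hy0, hy1⟩ := hy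
  obtain ⟨hz0, hz1⟩ := hz
  generalize scanLength β (scanEnd β y b D) b' D' = L' at *
  unfold scanEnd at hn2
  generalize scanLength β y b D = L at *
  unfold forwardDist at hn1 hn2
  split_ifs at hn1 hn2 <;> linarith

/-! ### Sparsity of the dependence graph for large bids. -/

section PanState

variable {A : Type*} {B : A → ℝ} {I : ℕ → Impression A}

theorem panState_start_mem (hB : ∀ a, 0 < B a) (t : ℕ) (a : A) :
    (panState B I t).start a ∈ Set.Ico 0 (B a) := by
  induction t with
  | zero => exact ⟨le_rfl, hB a⟩
  | succ t ih =>
    simp only [panState, PanState.next]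
    split_ifs
    · exact scanEnd_mem ih
    · exact ih

theorem panState_fixed_mono (a : A) {s t : ℕ} (hst : s ≤ t) :
    (panState B I s).fixed a ⊆ (panState B I t).fixed a := by
  induction t, hst using Nat.le_induction with
  | base => exact subset_rfl
  | succ t _ ih =>
    refine ih.trans ?_
    simp only [panState, PanState.next]
    split_ifs
    · exact Set.subset_union_left
    · exact subset_rfl

theorem panSubset_subset_fixed {a : A} {t : ℕ} (h : (I t).decision = .deterministic a) :
    panSubset B I t a ⊆ (panState B I (t + 1)).fixed a := by
  simp only [panState, PanState.next, if_pos h]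
  exact Set.subset_union_right

theorem semiAssigned_panPairs_iff {t : ℕ} {a : A} {y : ℝ} :
    SemiAssigned (panPairs B I) t a y ↔
      ∃ p, (I t).decision = .randomized p ∧ (∃ s, p s = a) ∧ y ∈ panSubset B I t a := by
  unfold SemiAssigned panPairs
  rcases hd : (I t).decision with b | p
  · simp
  · constructor
    · rintro ⟨c, hc, s, hs, hy⟩
      obtain rfl := Option.some.inj hc
      simp only at hs hy
      rw [hs] at hy
      exact ⟨p, rfl, ⟨s, hs⟩, hy⟩
    · rintro ⟨p', hp, ⟨s, hs⟩, hy⟩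
      obtain rfl := Decision.randomized.inj hp
      exact ⟨_, rfl, s, hs, by simpa only [hs] using hy⟩

/-- The impression `t` is assigned or semi-assigned to `a`, with a positive bid. -/
def Bids (I : ℕ → Impression A) (a : A) (t : ℕ) : Prop :=
  (I t).decision.Chooses a ∧ (I t).bid a ≠ 0

theorem bids_of_semiAssigned (hB : ∀ a, 0 < B a) {t : ℕ} {a : A} {y : ℝ}
    (h : SemiAssigned (panPairs B I) t a y) : Bids I a t := by
  obtain ⟨p, hp, ⟨s, hs⟩, hy⟩ := semiAssigned_panPairs_iff.1 h
  constructor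
  · rw [hp]
    cases s
    · exact Or.inl hs.symm
    · exact Or.inr hs.symm
  · intro h0
    unfold panSubset PanState.subset at hy
    rw [h0, scanSet_zero (panState_start_mem hB t a)] at hy
    exact hy

/-- The marker stays in place in rounds without `a`, and a zero bid scans an arc of length zero. -/
theorem panState_start_eq (hB : ∀ a, 0 < B a) {a : A} {s t : ℕ} (hst : s ≤ t)
    (h : ∀ u, s ≤ u → u < t → ¬ Bids I a u) :
    (panState B I t).start a = (panState B I s).start a := by
  induction t, hst using Nat.le_induction with
  | base => rfl
  | succ t hst ih =>
    rw [← ih fun u hu hut => h u hu (hut.trans (Nat.lt_succ_self t))]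
    simp only [panState, PanState.next]
    split_ifs with hc
    · have hb : (I t).bid a = 0 := by
        by_contra hb
        exact h t hst (Nat.lt_succ_self t) ⟨hc, hb⟩
      rw [hb, scanEnd_zero (panState_start_mem hB t a)]
    · rfl

theorem mem_panSubset_or (hB : ∀ a, 0 < B a) (hV : ValidInstance B I) (hL : LargeBids B I) {a : A}
    {s t : ℕ} (hst : s < t) (hs : Bids I a s) (ht : Bids I a t)
    (h : ∀ u, s < u → u < t → ¬ Bids I a u) {y : ℝ} (hy : y ∈ Set.Ico 0 (B a))
    (hD : y ∉ (panState B I t).fixed a) : y ∈ panSubset B I s a ∨ y ∈ panSubset B I t a := by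
  have hstart : (panState B I t).start a =
      scanEnd (B a) ((panState B I s).start a) ((I s).bid a) ((panState B I s).fixed a) := by
    rw [panState_start_eq hB hst fun u hu => h u hu]
    simp only [panState, PanState.next, if_pos hs.1]
  unfold panSubset PanState.subset
  rw [hstart]
  exact mem_scanSet_or (panState_start_mem hB s a) ((hL s a).resolve_left hs.2) (hV.bid_le s a)
    ((hL t a).resolve_left ht.2) (hV.bid_le t a) hy
    (fun hD' => hD (panState_fixed_mono a hst.le hD')) hD

theorem mem_panSubset {t : ℕ} {a : A} {y : ℝ} (h : y ∈ panSubset B I t a) :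
    y ∈ Set.Ico 0 (B a) ∧ y ∉ (panState B I t).fixed a :=
  ⟨h.1.1, h.2⟩

/-- At most one round strictly between the ends of an arc offers the advertiser a nonempty
subset. -/
theorem not_semiAssigned_twice_of_arc (hB : ∀ a, 0 < B a) (hV : ValidInstance B I)
    (hL : LargeBids B I) {a : A} {s r r' t : ℕ} {z z' : ℝ}
    (harc : SenderReceiver.Arc (panPairs B I) a s t) (hsr : s < r) (hrr' : r < r') (hrt : r' < t)
    (h : SemiAssigned (panPairs B I) r a z) (h' : SemiAssigned (panPairs B I) r' a z') : False := by
  classical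
  obtain ⟨hst, y, -, hyt, hbetween⟩ := harc
  obtain ⟨-, -, -, hyt'⟩ := semiAssigned_panPairs_iff.1 hyt
  obtain ⟨hy0, hyD⟩ := mem_panSubset hyt'
  have hr := bids_of_semiAssigned hB h
  -- The covering property concerns consecutive bids, so `r'` is replaced by the first bid `v` after
  -- `r`.
  have hex : ∃ v, r < v ∧ Bids I a v := ⟨r', hrr', bids_of_semiAssigned hB h'⟩
  obtain ⟨hrv, hv⟩ := Nat.find_spec hex
  have hvr : Nat.find hex ≤ r' := Nat.find_min' hex ⟨hrr', bids_of_semiAssigned hB h'⟩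
  set v := Nat.find hex
  -- A deterministic round containing `y` would exclude `y` from the subset of round `t`, and a
  -- randomized one would interrupt the arc.
  have hnot : ∀ u, s < u → u < t → Bids I a u → y ∉ panSubset B I u a := by
    intro u hsu hut hu hy
    have hc := hu.1
    rcases hd : (I u).decision with b | p
    · rw [hd] at hc
      obtain rfl : a = b := hc
      exact hyD (panState_fixed_mono a hut (panSubset_subset_fixed hd hy))
    · rw [hd] at hc
      refine hbetween u hsu hut (semiAssigned_panPairs_iff.2 ⟨p, hd, ?_, hy⟩)
      rcases hc with hc | hc
      · exact ⟨_, hc.symm⟩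
      · exact ⟨_, hc.symm⟩
  rcases mem_panSubset_or hB hV hL hrv hr hv
    (fun u hru huv hu => Nat.find_min hex huv ⟨hru, hu⟩) hy0
    (fun hD => hyD (panState_fixed_mono a (by omega) hD)) with hy | hy
  · exact hnot r hsr (by omega) hr hy
  · exact hnot v (by omega) (by omega) hv hy

end PanState

/-! ### Expectations over finitely many independent coordinates -/

section FinExp

variable {X : Type*} [Fintype X]

/-- The average of `f` over a new choice of the coordinate `i` with weights `w`. -/
noncomputable def resample (w : X → ℝ) (i : ℕ) (f : (ℕ → X) → ℝ) (κ : ℕ → X) : ℝ :=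
  ∑ x, w x * f (Function.update κ i x)

variable {w : X → ℝ}

theorem resample_const (h1 : ∑ x, w x = 1) (i : ℕ) (a : ℝ) :
    resample w i (fun _ => a) = fun _ => a := by
  funext κ
  simp only [resample, ← Finset.sum_mul, h1, one_mul]

theorem resample_self (h1 : ∑ x, w x = 1) (i : ℕ) (f : (ℕ → X) → ℝ) :
    resample w i (resample w i f) = resample w i f := by
  funext κ
  simp only [resample, Function.update_idem, ← Finset.sum_mul, h1, one_mul]

theorem resample_comm {i j : ℕ} (hij : i ≠ j) (f : (ℕ → X) → ℝ) :
    resample w i (resample w j f) = resample w j (resample w i f) := by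
  funext κ
  simp only [resample, Finset.mul_sum]
  rw [Finset.sum_comm]
  refine Finset.sum_congr rfl fun x _ => Finset.sum_congr rfl fun x' _ => ?_
  rw [Function.update_comm hij]
  ring

/-- The expectation of `f` when the first `n` coordinates are independent with weights `w`, and
all others have the default value. -/
noncomputable def finExp [Inhabited X] (w : X → ℝ) : ℕ → ((ℕ → X) → ℝ) → ℝ
  | 0, f => f default
  | n + 1, f => finExp w n (resample w n f)

variable [Inhabited X]

theorem finExp_add (n : ℕ) (f g : (ℕ → X) → ℝ) :
    finExp w n (fun κ => f κ + g κ) = finExp w n f + finExp w n g := by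
  induction n generalizing f g with
  | zero => rfl
  | succ n ih =>
    simp only [finExp]
    rw [← ih]
    congr 1
    funext κ
    simp only [resample, mul_add, Finset.sum_add_distrib]

theorem finExp_const_mul (n : ℕ) (a : ℝ) (f : (ℕ → X) → ℝ) :
    finExp w n (fun κ => a * f κ) = a * finExp w n f := by
  induction n generalizing f with
  | zero => rfl
  | succ n ih =>
    simp only [finExp]
    rw [← ih]
    congr 1
    funext κ
    simp only [resample, Finset.mul_sum]
    exact Finset.sum_congr rfl fun x _ => by ring

theorem finExp_zero_fun (n : ℕ) : finExp w n (fun _ => 0) = 0 := by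
  simpa using finExp_const_mul (w := w) n 0 fun _ => 0

theorem finExp_sum {ι : Type*} (n : ℕ) (S : Finset ι) (f : ι → (ℕ → X) → ℝ) :
    finExp w n (fun κ => ∑ i ∈ S, f i κ) = ∑ i ∈ S, finExp w n (f i) := by
  classical
  induction S using Finset.induction_on with
  | empty => simpa using finExp_zero_fun n
  | insert i S hi ih =>
    simp only [Finset.sum_insert hi]
    rw [finExp_add, ih]

theorem finExp_mono (hw : ∀ x, 0 ≤ w x) (n : ℕ) {f g : (ℕ → X) → ℝ} (h : ∀ κ, f κ ≤ g κ) :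
    finExp w n f ≤ finExp w n g := by
  induction n generalizing f g with
  | zero => exact h _
  | succ n ih =>
    exact ih fun κ => Finset.sum_le_sum fun x _ => mul_le_mul_of_nonneg_left (h _) (hw x)

theorem finExp_const (h1 : ∑ x, w x = 1) (n : ℕ) (a : ℝ) : finExp w n (fun _ => a) = a := by
  induction n with
  | zero => rfl
  | succ n ih => rw [finExp, resample_const h1, ih]

/-- Resampling is idempotent and commutes with resampling another coordinate, so it can be absorbed
into the averaging over coordinate `i`. -/
theorem finExp_resample (h1 : ∑ x, w x = 1) {i n : ℕ} (hi : i < n) (f : (ℕ → X) → ℝ) :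
    finExp w n (resample w i f) = finExp w n f := by
  induction n generalizing f with
  | zero => omega
  | succ n ih =>
    simp only [finExp]
    rcases Nat.lt_succ_iff_lt_or_eq.1 hi with h | rfl
    · rw [resample_comm h.ne', ih h]
    · rw [resample_self h1]

/-- Conditioning on an event which concerns a single coordinate. -/
theorem finExp_ite (h1 : ∑ x, w x = 1) {i n : ℕ} (hi : i < n) (p : X → Prop) [DecidablePred p]
    {h h' : (ℕ → X) → ℝ} (hh : ∀ κ x, p x → h (Function.update κ i x) = h' κ) :
    finExp w n (fun κ => if p (κ i) then h κ else 0) =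
      (∑ x, if p x then w x else 0) * finExp w n h' := by
  rw [← finExp_resample h1 hi, ← finExp_const_mul]
  congr 1
  funext κ
  simp only [resample, Function.update_self, Finset.sum_mul]
  refine Finset.sum_congr rfl fun x _ => ?_
  split_ifs with hp
  · rw [hh κ x hp]
  · simp

theorem finExp_prod (h1 : ∑ x, w x = 1) {ι : Type*} {n : ℕ} (T : Finset ι) {v : ι → ℕ}
    (hv : Set.InjOn v T) (hT : ∀ i ∈ T, v i < n) (f : ι → X → ℝ) :
    finExp w n (fun κ => ∏ i ∈ T, f i (κ (v i))) = ∏ i ∈ T, ∑ x, w x * f i x := by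
  classical
  induction T using Finset.induction_on with
  | empty => simpa using finExp_const h1 n 1
  | insert i T hi ih =>
    rw [Finset.prod_insert hi, ← ih (hv.mono (by simp))
      fun j hj => hT j (Finset.mem_insert_of_mem hj),
      ← finExp_resample h1 (hT i (Finset.mem_insert_self i T)), ← finExp_const_mul]
    congr 1
    funext κ
    simp only [resample, Finset.sum_mul]
    refine Finset.sum_congr rfl fun x _ => ?_
    rw [Finset.prod_insert hi, Function.update_self, mul_assoc]
    congr 2
    refine Finset.prod_congr rfl fun j hj => ?_
    rw [Function.update_of_ne]
    intro h
    have hji : j = i := hv (by simp [hj]) (by simp) h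
    exact hi (hji ▸ hj)

/-- Splitting coordinates that are pairs of independent choices. -/
theorem finExp_split {Y Z : Type*} [Fintype Y] [Inhabited Y] [Fintype Z] [Inhabited Z]
    {w' : Y → ℝ} {w'' : Z → ℝ} (mk : X → Y → Z) (hd : mk default default = default)
    (hmk : ∀ g : Z → ℝ, ∑ z, w'' z * g z = ∑ x, w x * ∑ y, w' y * g (mk x y)) (n : ℕ)
    (f : (ℕ → Z) → ℝ) :
    finExp w'' n f = finExp w n fun κ => finExp w' n fun τ => f fun i => mk (κ i) (τ i) := by
  induction n generalizing f with
  | zero =>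
    simp only [finExp]
    congr 1
    funext i
    exact hd.symm
  | succ n ih =>
    simp only [finExp]
    rw [ih]
    congr 1
    funext κ
    simp only [resample]
    simp_rw [hmk]
    rw [finExp_sum]
    refine Finset.sum_congr rfl fun x _ => ?_
    rw [finExp_const_mul]
    congr 2
    funext τ
    refine Finset.sum_congr rfl fun y _ => ?_
    congr 2
    funext i
    by_cases h : i = n
    · subst h
      simp
    · simp [Function.update_of_ne h]

end FinExp

/-! ### The probability that no arc of a chain is realized -/

namespace SenderReceiver

/-- The part of the random choices of a node that determines which arcs are picked: whether it is
a sender, and the side and the index of the arc that it picks. -/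
abbrev Coarse := Bool × Bool × Bool

noncomputable def coarseWeight (x : Coarse) : ℝ := (if x.1 = true then 4 / 9 else 5 / 9) / 4

theorem coarseWeight_nonneg (x : Coarse) : 0 ≤ coarseWeight x := by
  unfold coarseWeight
  split_ifs <;> norm_num

theorem sum_coarse {M : Type*} [AddCommMonoid M] (f : Coarse → M) :
    ∑ x, f x = ((f (true, true, true) + f (true, true, false)) +
      (f (true, false, true) + f (true, false, false))) +
      ((f (false, true, true) + f (false, true, false)) +
      (f (false, false, true) + f (false, false, false))) := by
  simp only [Fintype.sum_prod_type, Fintype.sum_bool]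

theorem sum_coarseWeight : ∑ x, coarseWeight x = 1 := by
  rw [sum_coarse]
  norm_num [coarseWeight]

theorem sum_receiver : (∑ x : Coarse, if x.1 = false then coarseWeight x else 0) = 5 / 9 := by
  rw [sum_coarse]
  norm_num [coarseWeight]

theorem sum_sender : (∑ x : Coarse, if x.1 = true then coarseWeight x else 0) = 4 / 9 := by
  rw [sum_coarse]
  norm_num [coarseWeight]

theorem sum_eq_label {l : Coarse} (hl : l.1 = true) :
    (∑ x : Coarse, if x = l then coarseWeight x else 0) = 1 / 9 := by
  rw [Finset.sum_ite_eq' Finset.univ l, if_pos (Finset.mem_univ l)]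
  norm_num [coarseWeight, hl]

theorem sum_sender_ne_label {l : Coarse} (hl : l.1 = true) :
    (∑ x : Coarse, if x.1 = true ∧ x ≠ l then coarseWeight x else 0) = 1 / 3 := by
  have h : (∑ x : Coarse, if x.1 = true then coarseWeight x else 0) =
      (∑ x : Coarse, if x = l then coarseWeight x else 0) +
        ∑ x : Coarse, if x.1 = true ∧ x ≠ l then coarseWeight x else 0 := by
    rw [← Finset.sum_add_distrib]
    refine Finset.sum_congr rfl fun x _ => ?_
    by_cases hx : x = l
    · subst hx
      simp [hl]
    · simp [hx]
  rw [sum_sender, sum_eq_label hl] at h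
  linarith

/-- The sets `D j` consist of competitors of the arc from `u j` to `u (j + 1)`. A competitor
`(s, x)` stands for the event that the node `s` is in state `x`, in which it picks another arc
to `u (j + 1)`. -/
structure Competitors (u : ℕ → ℕ) (l : ℕ → Coarse) (D : ℕ → Finset (ℕ × Coarse)) : Prop where
  card_le : ∀ j, (D j).card ≤ 3
  sender : ∀ j, ∀ c ∈ D j, c.2.1 = true
  lt : ∀ j, ∀ c ∈ D j, c.1 < u (j + 1)
  ne : ∀ i j, ∀ c ∈ D j, c ≠ (u i, l i)
  disjoint : ∀ i j c, c ∈ D i → c ∈ D j → i = j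

/-- The number of competitors that are present. -/
noncomputable def rivals (C : Finset (ℕ × Coarse)) (κ : ℕ → Coarse) : ℝ :=
  ∑ c ∈ C, if κ c.1 = c.2 then 1 else 0

theorem rivals_nonneg (C : Finset (ℕ × Coarse)) (κ : ℕ → Coarse) : 0 ≤ rivals C κ :=
  Finset.sum_nonneg fun c _ => by split_ifs <;> norm_num

/-- The competitors other than those in which `s` is the sender. -/
def dropSource (D : ℕ → Finset (ℕ × Coarse)) (s : ℕ) (j : ℕ) : Finset (ℕ × Coarse) :=
  (D j).filter fun c => c.1 ≠ s

/-- An upper bound for the probability that the arc from `u j` to `u (j + 1)` is not realized,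
given the coarse states. -/
noncomputable def missFactor (u : ℕ → ℕ) (l : ℕ → Coarse) (D : ℕ → Finset (ℕ × Coarse)) (j : ℕ)
    (κ : ℕ → Coarse) : ℝ :=
  if κ (u j) = l j ∧ (κ (u (j + 1))).1 = false then rivals (D j) κ / 2 else 1

/-- The arcs among the first `m` ones of the chain which avoid the nodes in `K`. -/
def arcsAvoiding (m : ℕ) (K : Finset ℕ) : Finset ℕ :=
  (Finset.range m).filter fun j => j ∉ K ∧ j + 1 ∉ K

/-- The nodes in `K` are those fixed by conditioning in states that disable their arcs. -/
noncomputable def missProd (u : ℕ → ℕ) (l : ℕ → Coarse) (D : ℕ → Finset (ℕ × Coarse)) (m : ℕ)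
    (K : Finset ℕ) (κ : ℕ → Coarse) : ℝ :=
  ∏ j ∈ arcsAvoiding m K, missFactor u l D j κ

variable {u : ℕ → ℕ} {l : ℕ → Coarse} {D : ℕ → Finset (ℕ × Coarse)}

theorem Competitors.dropSource (h : Competitors u l D) (s : ℕ) :
    Competitors u l (dropSource D s) where
  card_le j := (Finset.card_filter_le _ _).trans (h.card_le j)
  sender j c hc := h.sender j c (Finset.mem_filter.1 hc).1
  lt j c hc := h.lt j c (Finset.mem_filter.1 hc).1
  ne i j c hc := h.ne i j c (Finset.mem_filter.1 hc).1
  disjoint i j c hi hj := h.disjoint i j c (Finset.mem_filter.1 hi).1 (Finset.mem_filter.1 hj).1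

/-- A node has only one state: once `s` is in a state `x` which is not a competitor in `D j`, no
competitor with sender `s` is present. -/
theorem rivals_update {j s : ℕ} {x : Coarse} (h : (s, x) ∉ D j) (κ : ℕ → Coarse) :
    rivals (D j) (Function.update κ s x) = rivals (dropSource D s j) κ := by
  unfold rivals dropSource
  rw [Finset.sum_filter]
  refine Finset.sum_congr rfl fun c hc => ?_
  by_cases hs : c.1 = s
  · have hx : x ≠ c.2 := by
      rintro rfl
      exact h (by rw [← hs]; exact hc)
    subst hs
    simp [hx]
  · simp [hs]

theorem rivals_update_of_ge (hD : Competitors u l D) {j s : ℕ} (hs : u (j + 1) ≤ s) (x : Coarse)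
    (κ : ℕ → Coarse) : rivals (D j) (Function.update κ s x) = rivals (D j) κ := by
  unfold rivals
  refine Finset.sum_congr rfl fun c hc => ?_
  rw [Function.update_of_ne ((hD.lt j c hc).trans_le hs).ne]

theorem missFactor_update {j s : ℕ} {x : Coarse} (h1 : s ≠ u j) (h2 : s ≠ u (j + 1))
    (h : (s, x) ∉ D j) (κ : ℕ → Coarse) :
    missFactor u l D j (Function.update κ s x) = missFactor u l (dropSource D s) j κ := by
  unfold missFactor
  rw [rivals_update h, Function.update_of_ne h1.symm, Function.update_of_ne h2.symm]

theorem missFactor_update_of_gt (hD : Competitors u l D) (hu : StrictMono u) {j s : ℕ}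
    (hs : u (j + 1) < s) (x : Coarse) (κ : ℕ → Coarse) :
    missFactor u l D j (Function.update κ s x) = missFactor u l D j κ := by
  unfold missFactor
  rw [rivals_update_of_ge hD hs.le, Function.update_of_ne hs.ne,
    Function.update_of_ne ((hu (Nat.lt_succ_self j)).trans hs).ne]

theorem missFactor_update_tail {j : ℕ} {x : Coarse} (hx : x ≠ l j) (κ : ℕ → Coarse) :
    missFactor u l D j (Function.update κ (u j) x) = 1 := by
  unfold missFactor
  rw [Function.update_self, if_neg fun h => hx h.1]

theorem missFactor_update_head {j : ℕ} {x : Coarse} (hx : x.1 = true) (κ : ℕ → Coarse) :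
    missFactor u l D j (Function.update κ (u (j + 1)) x) = 1 := by
  unfold missFactor
  rw [Function.update_self, if_neg fun h => by simp [hx] at h]

/-- Both arcs at `u k` get the factor `1`: the outgoing one is not picked in state `x`, and the
incoming one ends at a sender. -/
theorem missProd_update_source (hu : StrictMono u) {m k : ℕ} {K : Finset ℕ} {x : Coarse}
    (hx : x.1 = true) (hxl : x ≠ l k) (h : ∀ j < m, (u k, x) ∉ D j) (κ : ℕ → Coarse) :
    missProd u l D m K (Function.update κ (u k) x) =
      missProd u l (dropSource D (u k)) m (insert k K) κ := by
  unfold missProd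
  have hsub : arcsAvoiding m (insert k K) ⊆ arcsAvoiding m K := by
    intro j hj
    simp only [arcsAvoiding, Finset.mem_filter, Finset.mem_insert, not_or] at hj ⊢
    exact ⟨hj.1, hj.2.1.2, hj.2.2.2⟩
  rw [← Finset.prod_subset hsub (f := fun j => missFactor u l D j (Function.update κ (u k) x))]
  · refine Finset.prod_congr rfl fun j hj => ?_
    simp only [arcsAvoiding, Finset.mem_filter, Finset.mem_insert, not_or, Finset.mem_range] at hj
    exact missFactor_update (fun e => hj.2.1.1 (hu.injective e).symm)
      (fun e => hj.2.2.1 (hu.injective e).symm) (h j hj.1) κ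
  · intro j hj hj'
    simp only [arcsAvoiding, Finset.mem_filter, Finset.mem_insert, not_or, Finset.mem_range]
      at hj hj'
    by_cases h1 : j = k
    · subst h1
      exact missFactor_update_tail hxl κ
    · by_cases h2 : j + 1 = k
      · subst h2
        exact missFactor_update_head hx κ
      · exact absurd ⟨hj.1, ⟨h1, hj.2.1⟩, h2, hj.2.2⟩ hj'

theorem missProd_update_outside {m s : ℕ} {K : Finset ℕ} {x : Coarse} (hs : ∀ k, s ≠ u k)
    (h : ∀ j < m, (s, x) ∉ D j) (κ : ℕ → Coarse) :
    missProd u l D m K (Function.update κ s x) = missProd u l (dropSource D s) m K κ := by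
  refine Finset.prod_congr rfl fun j hj => ?_
  exact missFactor_update (hs _) (hs _) (h j (Finset.mem_range.1 (Finset.mem_filter.1 hj).1)) κ

theorem missProd_update_of_gt (hD : Competitors u l D) (hu : StrictMono u) {m s : ℕ}
    (hs : u m < s) (K : Finset ℕ) (x : Coarse) (κ : ℕ → Coarse) :
    missProd u l D m K (Function.update κ s x) = missProd u l D m K κ := by
  refine Finset.prod_congr rfl fun j hj => ?_
  have hj' := Finset.mem_range.1 (Finset.mem_filter.1 hj).1
  exact missFactor_update_of_gt hD hu ((hu.monotone hj').trans_lt hs) x κ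

theorem missProd_zero (K : Finset ℕ) (κ : ℕ → Coarse) : missProd u l D 0 K κ = 1 := by
  simp [missProd, arcsAvoiding]

theorem arcsAvoiding_succ_of_mem {m : ℕ} {K : Finset ℕ} (h : m ∈ K ∨ m + 1 ∈ K) :
    arcsAvoiding (m + 1) K = arcsAvoiding m K := by
  unfold arcsAvoiding
  rw [Finset.range_add_one, Finset.filter_insert, if_neg (by tauto)]

theorem missProd_succ {m : ℕ} {K : Finset ℕ} (h : m ∉ K) (h' : m + 1 ∉ K) (κ : ℕ → Coarse) :
    missProd u l D (m + 1) K κ = missFactor u l D m κ * missProd u l D m K κ := by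
  unfold missProd arcsAvoiding
  rw [Finset.range_add_one, Finset.filter_insert, if_pos ⟨h, h'⟩, Finset.prod_insert (by simp)]

theorem arcsAvoiding_erase {m k : ℕ} (h : m < k) (K : Finset ℕ) :
    arcsAvoiding m (K.erase k) = arcsAvoiding m K := by
  unfold arcsAvoiding
  refine Finset.filter_congr fun j hj => ?_
  rw [Finset.mem_range] at hj
  rw [Finset.mem_erase, Finset.mem_erase]
  have h1 : j ≠ k := by omega
  have h2 : j + 1 ≠ k := by omega
  tauto

/-- When the last node of the chain is a sender, only the arcs before it matter. -/
theorem missProd_update_last (hD : Competitors u l D) (hu : StrictMono u) (m : ℕ) (K : Finset ℕ)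
    {x : Coarse} (hx : x.1 = true) (κ : ℕ → Coarse) :
    missProd u l D m K (Function.update κ (u m) x) = missProd u l D (m - 1) K κ := by
  rcases m with _ | m
  · rw [missProd_zero, missProd_zero]
  · rw [Nat.add_sub_cancel]
    by_cases h : m ∈ K ∨ m + 1 ∈ K
    · unfold missProd
      rw [arcsAvoiding_succ_of_mem h]
      exact missProd_update_of_gt hD hu (hu (Nat.lt_succ_self m)) K x κ
    · rw [missProd_succ (by tauto) (by tauto), missFactor_update_head hx, one_mul]
      exact missProd_update_of_gt hD hu (hu (Nat.lt_succ_self m)) K x κ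

noncomputable abbrev coarseExp (n : ℕ) (f : (ℕ → Coarse) → ℝ) : ℝ := finExp coarseWeight n f

/-- A bound for all chains with `m` arcs carries over to the event that a competitor of a later
arc is present: it amounts to the removal of at most one node of the chain. -/
theorem coarseExp_competitor_le (hu : StrictMono u) {n m : ℕ} {b : ℝ} (hb : 0 ≤ b)
    (hbound : ∀ K D, Competitors u l D → coarseExp n (missProd u l D m K) ≤ (6 / 5) ^ K.card * b)
    (hD : Competitors u l D) (K : Finset ℕ) {j : ℕ} (hj : m ≤ j) {c : ℕ × Coarse} (hc : c ∈ D j)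
    (hcn : c.1 < n) :
    coarseExp n (fun κ => if κ c.1 = c.2 then missProd u l D m K κ else 0) ≤
      1 / 9 * ((6 / 5) ^ (K.card + 1) * b) := by
  -- A state picks a single arc, so a competitor of arc `j` is not a competitor of an earlier one.
  have hnot : ∀ i < m, (c.1, c.2) ∉ D i := fun i hi hci => by
    have := hD.disjoint i j c hci hc
    omega
  by_cases hs : ∃ k, c.1 = u k
  · obtain ⟨k, hk⟩ := hs
    have hxl : c.2 ≠ l k := fun h => hD.ne k j c hc (Prod.ext hk h)
    rw [coarseExp, finExp_ite sum_coarseWeight hcn (fun x => x = c.2)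
      (h' := missProd u l (dropSource D (u k)) m (insert k K)), sum_eq_label (hD.sender j c hc)]
    · refine mul_le_mul_of_nonneg_left ((hbound _ _ (hD.dropSource _)).trans ?_) (by norm_num)
      refine mul_le_mul_of_nonneg_right ?_ hb
      exact pow_le_pow_right₀ (by norm_num) (Finset.card_insert_le k K)
    · rintro κ x rfl
      rw [hk] at hnot ⊢
      exact missProd_update_source hu (hD.sender j c hc) hxl hnot κ
  -- Off the chain no node has to be removed, and the extra factor 6/5 is given away.
  · push Not at hs
    rw [coarseExp, finExp_ite sum_coarseWeight hcn (fun x => x = c.2)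
      (h' := missProd u l (dropSource D c.1) m K), sum_eq_label (hD.sender j c hc)]
    · refine mul_le_mul_of_nonneg_left ((hbound _ _ (hD.dropSource _)).trans ?_) (by norm_num)
      refine mul_le_mul_of_nonneg_right ?_ hb
      exact pow_le_pow_right₀ (by norm_num) (Nat.le_succ _)
    · rintro κ x rfl
      exact missProd_update_outside hs hnot κ

/-- If the last node is a sender, the last arc has factor `1` and the remaining factors do not
involve that node. -/
theorem coarseExp_eq_receiver_add (hD : Competitors u l D) (hu : StrictMono u) {n m : ℕ}
    (hm : u m < n) (K : Finset ℕ) :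
    coarseExp n (missProd u l D m K) =
      coarseExp n (fun κ => if (κ (u m)).1 = false then missProd u l D m K κ else 0) +
        4 / 9 * coarseExp n (missProd u l D (m - 1) K) := by
  rw [← sum_sender, coarseExp, coarseExp, coarseExp, ← finExp_ite sum_coarseWeight hm
    (fun x => x.1 = true) fun κ x hx => missProd_update_last hD hu m K hx κ, ← finExp_add]
  congr 1
  funext κ
  rcases (κ (u m)).1 <;> simp

/-- The new head is a receiver with probability 5/9. The node `u m` is then a receiver, a sender not
picking the chain arc (1/3), or a sender picking it (1/9); only in the last case is the new factor
different from `1`, namely half the number of rivals. -/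
theorem coarseExp_receiver_succ_le (hl : ∀ j, (l j).1 = true) (hD : Competitors u l D)
    (hu : StrictMono u) {n m : ℕ} (hm : u (m + 1) < n) {K : Finset ℕ} (hK : m ∉ K)
    (hK' : m + 1 ∉ K) {b : ℝ} (hb0 : 0 ≤ b)
    (hb : ∀ c ∈ D m, coarseExp n (fun κ =>
      if κ c.1 = c.2 then missProd u l D (m - 1) K κ else 0) ≤ 1 / 9 * b) :
    coarseExp n (fun κ => if (κ (u (m + 1))).1 = false then missProd u l D (m + 1) K κ else 0) ≤
      5 / 9 * (coarseExp n (fun κ => if (κ (u m)).1 = false then missProd u l D m K κ else 0) +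
        1 / 3 * coarseExp n (missProd u l D (m - 1) K) + 1 / 54 * b) := by
  have hum : u m < u (m + 1) := hu (Nat.lt_succ_self m)
  have hstep : ∀ (κ : ℕ → Coarse) (x : Coarse), x.1 = false →
      missProd u l D (m + 1) K (Function.update κ (u (m + 1)) x) =
        (if κ (u m) = l m then rivals (D m) κ / 2 else 1) * missProd u l D m K κ := by
    intro κ x hx
    rw [missProd_succ hK hK', missProd_update_of_gt hD hu hum]
    unfold missFactor
    rw [rivals_update_of_ge hD le_rfl, Function.update_self, Function.update_of_ne hum.ne]
    simp [hx]
  rw [coarseExp, finExp_ite sum_coarseWeight hm (fun x => x.1 = false) hstep, sum_receiver]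
  refine mul_le_mul_of_nonneg_left ?_ (by norm_num)
  have hsplit : (fun κ => (if κ (u m) = l m then rivals (D m) κ / 2 else 1) *
      missProd u l D m K κ) = fun κ => ((if (κ (u m)).1 = false then missProd u l D m K κ else 0) +
        (if (κ (u m)).1 = true ∧ κ (u m) ≠ l m then missProd u l D m K κ else 0)) +
        ∑ c ∈ D m, if κ (u m) = l m then
          1 / 2 * (if κ c.1 = c.2 then missProd u l D m K κ else 0) else 0 := by
    funext κ
    by_cases h : κ (u m) = l m
    · have h1 : (κ (u m)).1 = true := by rw [h]; exact hl m
      rw [if_pos h, if_neg (by simp [h1]), if_neg (fun hh => hh.2 h), zero_add, zero_add, rivals,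
        Finset.sum_div, Finset.sum_mul]
      refine Finset.sum_congr rfl fun c _ => ?_
      rw [if_pos h]
      split_ifs <;> ring
    · rcases hx : (κ (u m)).1 <;> simp [h]
  rw [hsplit, finExp_add, finExp_add, finExp_sum]
  refine add_le_add (add_le_add le_rfl (le_of_eq ?_)) ?_
  · rw [← sum_sender_ne_label (hl m)]
    exact finExp_ite sum_coarseWeight (hum.trans hm) (fun x => x.1 = true ∧ x ≠ l m)
      fun κ x hx => missProd_update_last hD hu m K hx.1 κ
  -- Here 1/162 = 1/9 · 1/2 · 1/9: the label of `u m`, the weight of a rival, and the probability of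
  -- its state. Three rivals give 1/54.
  · have hterm : ∀ c ∈ D m, finExp coarseWeight n (fun κ => if κ (u m) = l m then
        1 / 2 * (if κ c.1 = c.2 then missProd u l D m K κ else 0) else 0) ≤ 1 / 162 * b := by
      intro c hc
      -- A rival sent by `u m` itself would require a state different from `l m`.
      by_cases hcm : c.1 = u m
      · have hcl : c.2 ≠ l m := fun h => hD.ne m m c hc (Prod.ext hcm h)
        have hz : (fun κ : ℕ → Coarse => if κ (u m) = l m then
            1 / 2 * (if κ c.1 = c.2 then missProd u l D m K κ else 0) else 0) = fun _ => 0 := by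
          funext κ
          split_ifs with h1 h2
          · rw [hcm] at h2
            exact absurd (h2.symm.trans h1) hcl
          · simp
          · rfl
        rw [hz, finExp_zero_fun]
        positivity
      · rw [finExp_ite sum_coarseWeight (hum.trans hm) (fun x => x = l m)
          (h' := fun κ => 1 / 2 * (if κ c.1 = c.2 then missProd u l D (m - 1) K κ else 0)),
          sum_eq_label (hl m), finExp_const_mul]
        · have := hb c hc
          simp only [coarseExp] at this
          linarith
        · rintro κ x rfl
          rw [Function.update_of_ne hcm, missProd_update_last hD hu m K (hl m)]
    have hsum := Finset.sum_le_card_nsmul _ _ _ hterm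
    rw [nsmul_eq_mul] at hsum
    have h3 : ((D m).card : ℝ) ≤ 3 := by exact_mod_cast hD.card_le m
    nlinarith

/-- The expectation decays at least as fast as for independent arcs, up to a factor for each of
the removed nodes. -/
theorem coarseExp_missProd_le_aux (hl : ∀ j, (l j).1 = true) (hu : StrictMono u) {n : ℕ} (m : ℕ)
    (hm : u m < n) (K : Finset ℕ) {D : ℕ → Finset (ℕ × Coarse)} (hD : Competitors u l D) :
    coarseExp n (missProd u l D m K) ≤ (6 / 5) ^ K.card * (461 / 486) ^ m ∧
      (1 ≤ m → m ∉ K →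
        coarseExp n (fun κ => if (κ (u m)).1 = false then missProd u l D m K κ else 0) ≤
          (6 / 5) ^ K.card * (245 / 461 * (461 / 486) ^ m)) := by
  induction m using Nat.strong_induction_on generalizing K D with
  | _ m ih =>
  have hP : (1 : ℝ) ≤ (6 / 5) ^ K.card := one_le_pow₀ (by norm_num)
  rcases m with _ | m
  · refine ⟨?_, fun h => absurd h (by norm_num)⟩
    have h0 : missProd u l D 0 K = fun _ => 1 := funext (missProd_zero K)
    rw [h0, coarseExp, finExp_const sum_coarseWeight, pow_zero, mul_one]
    exact hP
  have hum : u m < n := (hu (Nat.lt_succ_self m)).trans hm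
  have hum' : u (m - 1) < n := (hu.monotone (Nat.sub_le m 1)).trans_lt hum
  have hL : (0 : ℝ) < (461 / 486) ^ m := by positivity
  -- Removing the last node loses one arc, which is paid for by 5/6 ≤ 461/486.
  by_cases h1 : m + 1 ∈ K
  · refine ⟨?_, fun _ h => absurd h1 h⟩
    have heq : missProd u l D (m + 1) K = missProd u l D m (K.erase (m + 1)) := by
      funext κ
      unfold missProd
      rw [arcsAvoiding_succ_of_mem (Or.inr h1), arcsAvoiding_erase (Nat.lt_succ_self m)]
    rw [heq]
    refine (ih m (Nat.lt_succ_self m) hum _ hD).1.trans ?_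
    rw [← Finset.card_erase_add_one h1, pow_succ, pow_succ]
    have : (0 : ℝ) < (6 / 5) ^ (K.erase (m + 1)).card := by positivity
    nlinarith [mul_pos this hL]
  -- Removing the last but one node loses two arcs (one if `m = 0`). The factor 6/5 pays for them,
  -- also in the receiver bound: 5/9 · 5/6 · (486/461)^2 ≤ 245/461.
  by_cases h2 : m ∈ K
  · have heq : missProd u l D (m + 1) K = missProd u l D (m - 1) (K.erase m) := by
      funext κ
      unfold missProd
      rw [arcsAvoiding_succ_of_mem (Or.inl h2)]
      rcases m with _ | m
      · simp [arcsAvoiding]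
      · rw [arcsAvoiding_succ_of_mem (Or.inr h2), Nat.add_sub_cancel,
          arcsAvoiding_erase (Nat.lt_succ_self m)]
    have hQ : coarseExp n (missProd u l D (m - 1) (K.erase m)) ≤
        (5 / 6) * (6 / 5) ^ K.card * ((486 / 461) ^ 2 * (461 / 486) ^ (m + 1)) := by
      refine (ih (m - 1) (by omega) hum' _ hD).1.trans ?_
      rw [← Finset.card_erase_add_one h2]
      have : (0 : ℝ) < (6 / 5) ^ (K.erase m).card := by positivity
      rw [pow_succ (6 / 5 : ℝ), show (5 / 6 : ℝ) * ((6 / 5) ^ (K.erase m).card * (6 / 5)) =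
        (6 / 5) ^ (K.erase m).card by ring]
      refine mul_le_mul_of_nonneg_left ?_ this.le
      rcases m with _ | m
      · norm_num
      · rw [Nat.add_sub_cancel, pow_succ (461 / 486 : ℝ), pow_succ (461 / 486 : ℝ)]
        have : (0 : ℝ) < (461 / 486) ^ m := by positivity
        linarith
    have hpos : (0 : ℝ) < (6 / 5) ^ K.card * (461 / 486) ^ (m + 1) := by positivity
    constructor
    · rw [heq]
      linarith
    · intro _ _
      rw [coarseExp, finExp_ite sum_coarseWeight hm (fun x => x.1 = false)
        (h' := missProd u l D (m - 1) (K.erase m)), sum_receiver]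
      · simp only [coarseExp] at hQ
        linarith
      · intro κ x _
        rw [heq]
        exact missProd_update_of_gt hD hu (hu (by omega)) _ _ _
  have ha : coarseExp n (fun κ => if (κ (u (m + 1))).1 = false then
      missProd u l D (m + 1) K κ else 0) ≤
        (6 / 5) ^ K.card * (245 / 461 * (461 / 486) ^ (m + 1)) := by
    -- For one arc the value is 5/9 · (5/9 + 1/3 + 1/54) = 245/486, which is where 245/461 comes
    -- from. The receiver bound fails for `m = 0`, since 5/9 > 245/461.
    rcases m with _ | m
    · have h0 : missProd u l D 0 K = fun _ => 1 := funext (missProd_zero K)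
      have hstep := coarseExp_receiver_succ_le hl hD hu hm h2 h1 (b := 1) zero_le_one
        (fun c hc => le_of_eq (by
          rw [coarseExp, finExp_ite sum_coarseWeight ((hD.lt 0 c hc).trans hm) (fun x => x = c.2)
            (h' := fun _ => 1) (fun κ x _ => missProd_zero K _), sum_eq_label (hD.sender 0 c hc),
            finExp_const sum_coarseWeight]))
      have hR : coarseExp n (fun κ => if (κ (u 0)).1 = false then missProd u l D 0 K κ else 0) =
          5 / 9 := by
        rw [coarseExp, finExp_ite sum_coarseWeight hum (fun x => x.1 = false)
          (h' := fun _ => 1) (fun κ x _ => missProd_zero K _), finExp_const sum_coarseWeight,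
          sum_receiver, mul_one]
      rw [hR, Nat.zero_sub, h0] at hstep
      simp only [coarseExp, finExp_const sum_coarseWeight] at hstep ⊢
      refine hstep.trans ?_
      norm_num
      linarith
    · rw [Nat.add_sub_cancel] at hum'
      have hstep := coarseExp_receiver_succ_le hl hD hu hm h2 h1
        (b := (6 / 5) ^ (K.card + 1) * (461 / 486) ^ m) (by positivity)
        (fun c hc => coarseExp_competitor_le hu (by positivity)
          (fun K D hD => (ih m (by omega) hum' K hD).1) hD K (Nat.le_succ m) hc
          ((hD.lt _ c hc).trans hm))
      have hA := (ih (m + 1) (by omega) hum K hD).2 (by omega) h2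
      have hQ := (ih m (by omega) hum' K hD).1
      rw [Nat.add_sub_cancel] at hstep
      refine hstep.trans ?_
      have hpos : (0 : ℝ) < (6 / 5) ^ K.card * (461 / 486) ^ m := by positivity
      rw [pow_succ (461 / 486 : ℝ) m] at hA
      rw [pow_succ (6 / 5 : ℝ), pow_succ (461 / 486 : ℝ) (m + 1), pow_succ (461 / 486 : ℝ) m]
      linarith
  -- The two bounds fit together exactly: 4/9 + 245/486 = 461/486.
  refine ⟨?_, fun _ _ => ha⟩
  rw [coarseExp_eq_receiver_add hD hu hm, Nat.add_sub_cancel]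
  have hQ := (ih m (Nat.lt_succ_self m) hum K hD).1
  rw [pow_succ] at ha ⊢
  linarith

theorem coarseExp_missProd_le (hl : ∀ j, (l j).1 = true) (hu : StrictMono u) {n m : ℕ}
    (hm : u m < n) (hD : Competitors u l D) :
    coarseExp n (fun κ => ∏ j ∈ Finset.range m, missFactor u l D j κ) ≤ (461 / 486) ^ m := by
  have h := (coarseExp_missProd_le_aux hl hu m hm ∅ hD).1
  rw [Finset.card_empty, pow_zero, one_mul] at h
  convert h using 3
  unfold missProd arcsAvoiding
  rw [Finset.filter_true_of_mem (by simp)]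

end SenderReceiver

/-! ### From the infinite product measure to finite sums. -/

section InfinitePi

variable {S : Type*}

theorem exists_eq_comp_restrict [Inhabited S] {n : ℕ} {f : (ℕ → S) → ℝ}
    (hf : ∀ ω ω' : ℕ → S, (∀ i < n, ω i = ω' i) → f ω = f ω') :
    ∃ F : (Finset.range n → S) → ℝ, f = fun ω => F fun i => ω i := by
  refine ⟨fun r => f fun i => if h : i ∈ Finset.range n then r ⟨i, h⟩ else default, ?_⟩
  funext ω
  refine hf _ _ fun i hi => ?_
  rw [dif_pos (Finset.mem_range.2 hi)]

variable [MeasurableSpace S] [Fintype S] [MeasurableSingletonClass S]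

theorem integrable_comp_restrict (μ : Measure (ℕ → S)) [IsFiniteMeasure μ] {n : ℕ}
    (F : (Finset.range n → S) → ℝ) : Integrable (fun ω : ℕ → S => F fun i => ω i) μ := by
  obtain ⟨C, hC⟩ := (Set.finite_range fun r => ‖F r‖).bddAbove
  refine Integrable.of_bound (C := C) (Measurable.aestronglyMeasurable ?_) ?_
  · exact (measurable_of_countable F).comp (measurable_pi_lambda _ fun i => measurable_pi_apply _)
  · exact Filter.Eventually.of_forall fun ω => hC ⟨_, rfl⟩

variable [Inhabited S]

/-- Under an infinite product measure, the expectation of a function of the first `n` coordinates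
is a finite sum. -/
theorem integral_infinitePi_eq_finExp (ρ : Measure S) [IsProbabilityMeasure ρ] (n : ℕ)
    {f : (ℕ → S) → ℝ} (hf : ∀ ω ω' : ℕ → S, (∀ i < n, ω i = ω' i) → f ω = f ω') :
    ∫ ω, f ω ∂(Measure.infinitePi fun _ : ℕ => ρ) = finExp (fun x => ρ.real {x}) n f := by
  classical
  induction n generalizing f with
  | zero =>
    have hc : f = fun _ => f default := funext fun ω => hf _ _ (by simp)
    rw [hc]
    simp [finExp]
  | succ n ih =>
    rw [finExp, ← ih]
    swap
    · intro ω ω' h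
      refine Finset.sum_congr rfl fun x _ => ?_
      congr 1
      refine hf _ _ fun i hi => ?_
      by_cases hin : i = n
      · subst hin
        simp
      · rw [Function.update_of_ne hin, Function.update_of_ne hin]
        exact h i (by omega)
    have hdep : ∀ x, ∃ F : (Finset.range n → S) → ℝ,
        (fun ω : ℕ → S => f (Function.update ω n x)) = fun ω => F fun i => ω i := by
      intro x
      refine exists_eq_comp_restrict fun ω ω' h => hf _ _ fun i hi => ?_
      by_cases hin : i = n
      · subst hin
        simp
      · rw [Function.update_of_ne hin, Function.update_of_ne hin]
        exact h i (by omega)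
    choose F hF using hdep
    -- Expanding along the value of coordinate `n` makes each term a product of two independent
    -- factors.
    have hsum : f = fun ω => ∑ x, ({x} : Set S).indicator (fun _ => (1 : ℝ)) (ω n) *
        F x fun i => ω i := by
      funext ω
      rw [Finset.sum_eq_single (ω n)]
      · have := congrFun (hF (ω n)) ω
        simp only [Function.update_eq_self] at this
        simp [this]
      · intro x _ hx
        simp [hx.symm]
      · simp
    have hindep : IndepFun (fun ω : ℕ → S => ω n) (fun (ω : ℕ → S) (i : Finset.range n) => ω i)
        (Measure.infinitePi fun _ : ℕ => ρ) := by
      have h := iIndepFun_infinitePi (P := fun _ : ℕ => ρ) (X := fun _ x => x)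
        fun _ => measurable_id
      have h2 := h.indepFun_finset {n} (Finset.range n) (by simp)
        (fun i => measurable_pi_apply i)
      exact h2.comp (φ := fun r : (({n} : Finset ℕ) → S) => r ⟨n, by simp⟩) (ψ := id)
        (measurable_pi_apply _) measurable_id
    have hmeas : ∀ x : S, Measurable (({x} : Set S).indicator fun _ => (1 : ℝ)) := fun x =>
      measurable_of_countable _
    conv_lhs => rw [hsum]
    have hterm : ∀ x, ∫ ω : ℕ → S, ({x} : Set S).indicator (fun _ => (1 : ℝ)) (ω n) *
        F x (fun i => ω i) ∂(Measure.infinitePi fun _ : ℕ => ρ) =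
        ρ.real {x} * ∫ ω, f (Function.update ω n x) ∂(Measure.infinitePi fun _ : ℕ => ρ) := by
      intro x
      have h := (hindep.comp (hmeas x)
        (measurable_of_countable (F x))).integral_fun_mul_eq_mul_integral
        ((hmeas x).comp (measurable_pi_apply n)).aestronglyMeasurable
        ((measurable_of_countable (F x)).comp
          (measurable_pi_lambda _ fun i => measurable_pi_apply _)).aestronglyMeasurable
      refine h.trans ?_
      congr 1
      · have hmap := integral_map (μ := Measure.infinitePi fun _ : ℕ => ρ)
          (measurable_pi_apply n).aemeasurable (hmeas x).aestronglyMeasurable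
        rw [Measure.infinitePi_map_eval] at hmap
        exact hmap.symm.trans (integral_indicator_one (measurableSet_singleton x))
      · rw [hF x]
        rfl
    rw [integral_finsetSum]
    · simp_rw [hterm]
      unfold resample
      rw [integral_finsetSum]
      · simp_rw [integral_const_mul]
      · intro x _
        have := integrable_comp_restrict (Measure.infinitePi fun _ : ℕ => ρ) (F x)
        rw [← hF x] at this
        exact this.const_mul _
    · intro x _
      obtain ⟨G, hG⟩ := exists_eq_comp_restrict (n := n + 1) (f := fun ω : ℕ → S =>
        ({x} : Set S).indicator (fun _ => (1 : ℝ)) (ω n) * F x fun i => ω i) (by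
          intro ω ω' h
          rw [h n (by omega)]
          congr 2
          funext i
          exact h _ (by have := Finset.mem_range.1 i.2; omega))
      rw [hG]
      exact integrable_comp_restrict _ G

end InfinitePi

/-! ### The law of the seeds, split into three independent layers. -/

namespace SenderReceiver

theorem law_real_singleton (p : unitInterval) (r : Seed) :
    (law p).real {r} = (if r.1 = true then (p : ℝ) else 1 - p) * (1 / 96) := by
  obtain ⟨b, r⟩ := r
  unfold law
  rw [← Set.singleton_prod_singleton, measureReal_prod_prod,
    bernoulliMeasure_real_apply _ (by measurability)]
  congr 1
  · cases b <;> simp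
  · rw [measureReal_def, PMF.toMeasure_apply_singleton _ _ (by measurability)]
    simp

theorem integral_law_eq_finExp (p : unitInterval) (n : ℕ) {f : (ℕ → Seed) → ℝ}
    (hf : ∀ ω ω' : ℕ → Seed, (∀ i < n, ω i = ω' i) → f ω = f ω') :
    ∫ ω, f ω ∂(Measure.infinitePi fun _ : ℕ => law p) =
      finExp (fun r : Seed => (if r.1 = true then (p : ℝ) else 1 - p) * (1 / 96)) n f := by
  rw [integral_infinitePi_eq_finExp (law p) n hf]
  simp_rw [law_real_singleton]

/-- The random choices, composed of the coarse states, the numbers for the choice of an in-arc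
and the fresh bits. -/
def compose (κ : ℕ → Coarse) (τ : ℕ → Fin 12) (β : ℕ → Bool) (i : ℕ) : Seed :=
  ((κ i).1, (κ i).2, β i, τ i)

noncomputable abbrev tieExp (n : ℕ) (f : (ℕ → Fin 12) → ℝ) : ℝ := finExp (fun _ => 1 / 12) n f

noncomputable abbrev bitExp (n : ℕ) (f : (ℕ → Bool) → ℝ) : ℝ := finExp (fun _ => 1 / 2) n f

/-- The order of the layers matters: the coarse states determine the candidates, the numbers then
determine whose bit decides each round, and the fresh bits remain independent of both. -/
theorem integral_law_eq (n : ℕ) {f : (ℕ → Seed) → ℝ}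
    (hf : ∀ ω ω' : ℕ → Seed, (∀ i < n, ω i = ω' i) → f ω = f ω') {p : unitInterval}
    (hp : (p : ℝ) = 4 / 9) :
    ∫ ω, f ω ∂(Measure.infinitePi fun _ : ℕ => law p) =
      coarseExp n fun κ => tieExp n fun τ => bitExp n fun β => f (compose κ τ β) := by
  rw [integral_law_eq_finExp p n hf, hp]
  rw [finExp_split (X := Coarse) (Y := Fin 12 × Bool) (w := coarseWeight) (w' := fun _ => 1 / 24)
    (fun x y => (x.1, x.2, y.2, y.1)) rfl]
  · congr 1
    funext κ
    rw [finExp_split (X := Fin 12) (Y := Bool) (w := fun _ => 1 / 12) (w' := fun _ => 1 / 2)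
      Prod.mk rfl]
    · rfl
    · intro g
      rw [Fintype.sum_prod_type]
      refine Finset.sum_congr rfl fun x _ => ?_
      rw [Finset.mul_sum]
      refine Finset.sum_congr rfl fun y _ => ?_
      ring
  · intro g
    simp only [Fintype.sum_prod_type, Finset.mul_sum, coarseWeight]
    refine Finset.sum_congr rfl fun x _ => Finset.sum_congr rfl fun o _ =>
      Finset.sum_congr rfl fun b _ => ?_
    rw [Finset.sum_comm]
    refine Finset.sum_congr rfl fun i _ => Finset.sum_congr rfl fun c _ => ?_
    cases x <;> norm_num <;> ring

end SenderReceiver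

namespace SenderReceiver

variable {A : Type*} {P : ℕ → Option (ComboPair A)}

/-! ### The structure of the dependence graph -/

/-- A stream of pairs of combinations with different advertisers, such that at most one node
of an advertiser lies strictly between the ends of each of its arcs. -/
structure ShortArcs (P : ℕ → Option (ComboPair A)) : Prop where
  distinct : ∀ t c, P t = some c → (c false).adv ≠ (c true).adv
  between : ∀ a s t r r' z z', Arc P a s t → s < r → r < r' → r' < t → SemiAssigned P r a z →
    SemiAssigned P r' a z' → False

theorem ShortArcs.adv_injective (hP : ShortArcs P) {t : ℕ} {c : ComboPair A} (hc : P t = some c)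
    {i j : Bool} (h : (c i).adv = (c j).adv) : i = j := by
  have := hP.distinct t c hc
  cases i <;> cases j <;> simp_all

/-- The head of an earlier out-arc is a node of `a` between `s` and `t`, and there is at most one.
So every out-arc is the first or the second and can be picked. -/
theorem ShortArcs.outIndex_le_one (hP : ShortArcs P) {a : A} {s t : ℕ} (h : Arc P a s t) :
    outIndex P a s t ≤ 1 := by
  classical
  refine Finset.card_le_one.2 fun r hr r' hr' => ?_
  simp only [Finset.mem_filter, Finset.mem_Ioo] at hr hr'
  obtain ⟨⟨h1, h2⟩, -, z, -, hz, -⟩ := hr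
  obtain ⟨⟨h1', h2'⟩, -, z', -, hz', -⟩ := hr'
  rcases lt_trichotomy r r' with hlt | heq | hlt
  · exact (hP.between a s t r r' z z' h h1 hlt h2' hz hz').elim
  · exact heq
  · exact (hP.between a s t r' r z' z h h1' hlt h2 hz' hz).elim

theorem outIndex_lt {a : A} {s t t' : ℕ} (h : Arc P a s t) (htt : t < t') :
    outIndex P a s t < outIndex P a s t' := by
  classical
  refine Finset.card_lt_card (Finset.ssubset_iff.2 ⟨t, by simp, fun r hr => ?_⟩)
  simp only [Finset.mem_insert, Finset.mem_filter, Finset.mem_Ioo] at hr ⊢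
  rcases hr with rfl | ⟨⟨h1, h2⟩, h3⟩
  · exact ⟨⟨h.1, htt⟩, h⟩
  · exact ⟨⟨h1, h2.trans htt⟩, h3⟩

theorem eq_of_outIndex_eq {a : A} {s t t' : ℕ} (h : Arc P a s t) (h' : Arc P a s t')
    (he : outIndex P a s t = outIndex P a s t') : t = t' := by
  rcases lt_trichotomy t t' with hlt | heq | hlt
  · exact absurd he (outIndex_lt h hlt).ne
  · exact heq
  · exact absurd he (outIndex_lt h' hlt).ne'

theorem picks_iff_of_eq {ω ω' : ℕ → Seed} {a : A} {s t : ℕ} (h : (ω s).1 = (ω' s).1)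
    (h' : (ω s).2.1 = (ω' s).2.1) : Picks P ω a s t ↔ Picks P ω' a s t := by
  unfold Picks isSender outSide outSecond
  rw [h, h']

/-- The node `s` in state `x` picks its arc to `t` with respect to `a`. -/
def PicksWith (P : ℕ → Option (ComboPair A)) (x : Coarse) (a : A) (s t : ℕ) : Prop :=
  Picks P (fun _ => (x.1, x.2, false, 0)) a s t

theorem picks_compose_iff {κ : ℕ → Coarse} {τ : ℕ → Fin 12} {β : ℕ → Bool} {a : A} {s t : ℕ} :
    Picks P (compose κ τ β) a s t ↔ PicksWith P (κ s) a s t :=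
  picks_iff_of_eq rfl rfl

theorem ShortArcs.picksWith_unique (hP : ShortArcs P) {x x' : Coarse} {a : A} {s t : ℕ}
    (h : PicksWith P x a s t) (h' : PicksWith P x' a s t) : x = x' := by
  obtain ⟨-, h1, ⟨c, hc, ho⟩, hi⟩ := h
  obtain ⟨-, h1', ⟨c', hc', ho'⟩, hi'⟩ := h'
  obtain rfl := Option.some.inj (hc.symm.trans hc')
  have hside := hP.adv_injective hc (ho.trans ho'.symm)
  rw [hi] at hi'
  obtain ⟨x1, x2, x3⟩ := x
  obtain ⟨x1', x2', x3'⟩ := x'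
  simp only [isSender, outSide, outSecond] at *
  subst h1 h1' hside
  cases x3 <;> cases x3' <;> simp_all

/-- The state fixes the side and the index of the arc, and out-arcs with the same index have the
same head. -/
theorem picksWith_target_unique {x : Coarse} {a a' : A} {s t t' : ℕ}
    (h : PicksWith P x a s t) (h' : PicksWith P x a' s t') : t = t' := by
  obtain ⟨harc, -, ⟨c, hc, ho⟩, hi⟩ := h
  obtain ⟨harc', -, ⟨c', hc', ho'⟩, hi'⟩ := h'
  obtain rfl := Option.some.inj (hc.symm.trans hc')
  obtain rfl : a = a' := ho.symm.trans ho'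
  exact eq_of_outIndex_eq harc harc' (hi.trans hi'.symm)

theorem ShortArcs.exists_picksWith (hP : ShortArcs P) {a : A} {s t : ℕ} (h : Arc P a s t) :
    ∃ x : Coarse, x.1 = true ∧ PicksWith P x a s t := by
  obtain ⟨c, hc, o, ho, -⟩ := h.2.choose_spec.1
  refine ⟨(true, o, decide (outIndex P a s t = 1)), rfl, h, rfl, ⟨c, hc, ho⟩, ?_⟩
  have := hP.outIndex_le_one h
  simp only [outSecond, decide_eq_true_eq]
  split_ifs <;> omega

theorem ShortArcs.card_sources_le (hP : ShortArcs P) {a : A} {t : ℕ} (S : Finset ℕ)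
    (hS : ∀ s ∈ S, Arc P a s t) : S.card ≤ 2 := by
  by_contra! hcard
  -- Of three tails, the later two would both lie inside the arc that starts at the earliest.
  have key : ∀ r ∈ S, ∀ r' ∈ S, ∀ r'' ∈ S, r < r' → r' < r'' → False := by
    intro r hr r' hr' r'' hr'' h1 h2
    obtain ⟨-, z, hz, -, -⟩ := hS r' hr'
    obtain ⟨h3, z', hz', -, -⟩ := hS r'' hr''
    exact hP.between a r t r' r'' z z' (hS r hr) h1 h2 h3 hz hz'
  obtain ⟨x, hx, y, hy, z, hz, hxy, hxz, hyz⟩ := Finset.two_lt_card.1 hcard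
  have k1 := key x hx y hy z hz
  have k2 := key x hx z hz y hy
  have k3 := key y hy x hx z hz
  have k4 := key y hy z hz x hx
  have k5 := key z hz x hx y hy
  have k6 := key z hz y hy x hx
  rcases lt_or_gt_of_ne hxy with h1 | h1 <;> rcases lt_or_gt_of_ne hxz with h2 | h2 <;>
    rcases lt_or_gt_of_ne hyz with h3 | h3 <;>
    first
    | exact k1 h1 h3
    | exact k2 h2 h3
    | exact k3 h1 h2
    | exact k4 h3 h2
    | exact k5 h2 h1
    | exact k6 h3 h1

/-- The node `s` in state `x` picks an arc to `t`. -/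
def PicksInto (P : ℕ → Option (ComboPair A)) (t : ℕ) (q : ℕ × Coarse) : Prop :=
  ∃ c, P t = some c ∧ ∃ i, PicksWith P q.2 (c i).adv q.1 t

open scoped Classical in
/-- All ways in which an arc to `t` can be picked. -/
noncomputable def allPicks (P : ℕ → Option (ComboPair A)) (t : ℕ) : Finset (ℕ × Coarse) :=
  (Finset.range t ×ˢ Finset.univ).filter (PicksInto P t)

theorem mem_allPicks {t : ℕ} {q : ℕ × Coarse} : q ∈ allPicks P t ↔ PicksInto P t q := by
  simp only [allPicks, Finset.mem_filter, Finset.mem_product, Finset.mem_range, Finset.mem_univ,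
    and_true, and_iff_right_iff_imp]
  rintro ⟨c, -, i, h⟩
  exact h.1.1

theorem ShortArcs.card_allPicks_le (hP : ShortArcs P) (t : ℕ) : (allPicks P t).card ≤ 4 := by
  classical
  rcases hc : P t with _ | c
  · have : allPicks P t = ∅ := Finset.eq_empty_of_forall_notMem fun q hq => by
      obtain ⟨c, hc', -⟩ := mem_allPicks.1 hq
      simp [hc] at hc'
    simp [this]
  · have hside : ∀ i,
        ((allPicks P t).filter fun q => PicksWith P q.2 (c i).adv q.1 t).card ≤ 2 := by
      intro i
      rw [← Finset.card_image_of_injOn (f := Prod.fst)]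
      · refine hP.card_sources_le (a := (c i).adv) (t := t) _ fun s hs => ?_
        obtain ⟨q, hq, rfl⟩ := Finset.mem_image.1 hs
        exact (Finset.mem_filter.1 hq).2.1
      · intro q hq q' hq' h
        have h1 := (Finset.mem_filter.1 hq).2
        have h2 := (Finset.mem_filter.1 hq').2
        have h : q.1 = q'.1 := h
        rw [← h] at h2
        exact Prod.ext h (hP.picksWith_unique h1 h2)
    have hsub : allPicks P t ⊆
        ((allPicks P t).filter fun q => PicksWith P q.2 (c false).adv q.1 t) ∪
          (allPicks P t).filter fun q => PicksWith P q.2 (c true).adv q.1 t := by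
      intro q hq
      obtain ⟨c', hc', i, hi⟩ := mem_allPicks.1 hq
      obtain rfl := Option.some.inj (hc.symm.trans hc')
      rw [Finset.mem_union, Finset.mem_filter, Finset.mem_filter]
      cases i
      · exact Or.inl ⟨hq, hi⟩
      · exact Or.inr ⟨hq, hi⟩
    have h1 := hside false
    have h2 := hside true
    have h3 := (Finset.card_le_card hsub).trans (Finset.card_union_le _ _)
    omega

/-! ### The node whose fresh bit decides the selection -/

/-- The candidates, as a function of the coarse states. -/
noncomputable def coarseCandidates (P : ℕ → Option (ComboPair A)) (κ : ℕ → Coarse) (t : ℕ) :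
    List (ℕ × Bool) :=
  candidates P (compose κ (fun _ => 0) fun _ => false) t

theorem candidates_compose (κ : ℕ → Coarse) (τ : ℕ → Fin 12) (β : ℕ → Bool) (t : ℕ) :
    candidates P (compose κ τ β) t = coarseCandidates P κ t := by
  classical
  unfold coarseCandidates candidates
  refine List.filter_congr fun q _ => ?_
  rw [decide_eq_decide]
  simp only [picks_compose_iff]

theorem mem_coarseCandidates {κ : ℕ → Coarse} {t : ℕ} {q : ℕ × Bool} :
    q ∈ coarseCandidates P κ t ↔ ∃ c, P t = some c ∧ PicksWith P (κ q.1) (c q.2).adv q.1 t := by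
  classical
  unfold coarseCandidates candidates
  rw [List.mem_filter, decide_eq_true_eq]
  simp only [picks_compose_iff, and_iff_right_iff_imp]
  rintro ⟨c, -, h⟩
  obtain ⟨s, i⟩ := q
  exact List.mem_product.2 ⟨List.mem_range.2 h.1.1, by cases i <;> simp⟩

theorem nodup_coarseCandidates (κ : ℕ → Coarse) (t : ℕ) : (coarseCandidates P κ t).Nodup := by
  classical
  unfold coarseCandidates candidates
  exact (List.Nodup.product List.nodup_range (by simp)).filter _

/-- The in-arc that is chosen by the node `t` if it is a receiver with the number `r`. -/
noncomputable def chosen (P : ℕ → Option (ComboPair A)) (κ : ℕ → Coarse) (t : ℕ) (r : Fin 12) :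
    Option (ℕ × Bool) :=
  if (κ t).1 = true then none
  else (coarseCandidates P κ t)[(r : ℕ) % (coarseCandidates P κ t).length]?

/-- The node whose fresh bit decides the selection at the node `t`. -/
noncomputable def source (P : ℕ → Option (ComboPair A)) (κ : ℕ → Coarse) (t : ℕ) (r : Fin 12) :
    ℕ :=
  ((chosen P κ t r).map Prod.fst).getD t

theorem mem_of_chosen {κ : ℕ → Coarse} {t : ℕ} {r : Fin 12} {q : ℕ × Bool}
    (h : chosen P κ t r = some q) : q ∈ coarseCandidates P κ t := by
  unfold chosen at h
  split_ifs at h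
  exact List.mem_of_getElem? h

open scoped Classical in
theorem select_compose_eq (κ : ℕ → Coarse) (τ : ℕ → Fin 12) (β : ℕ → Bool) (t : ℕ) :
    select P (compose κ τ β) t = match chosen P κ t (τ t) with
      | none => β t
      | some (s, i) => if ∃ c c', P t = some c ∧ P s = some c' ∧
          (c' (β s)).adv = (c i).adv then !i else i := by
  unfold select chosen
  rw [candidates_compose]
  change (if (κ t).1 = true then β t else _) = _
  split_ifs with h
  · rfl
  · rfl

theorem select_compose_of_none {κ : ℕ → Coarse} {τ : ℕ → Fin 12} {t : ℕ}
    (h : chosen P κ t (τ t) = none) (β : ℕ → Bool) : select P (compose κ τ β) t = β t := by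
  rw [select_compose_eq, h]

open scoped Classical in
theorem select_compose_of_some {κ : ℕ → Coarse} {τ : ℕ → Fin 12} {t s : ℕ} {i : Bool}
    (h : chosen P κ t (τ t) = some (s, i)) (β : ℕ → Bool) :
    select P (compose κ τ β) t = if ∃ c c', P t = some c ∧ P s = some c' ∧
      (c' (β s)).adv = (c i).adv then !i else i := by
  rw [select_compose_eq, h]

/-- With the coarse states and numbers fixed, a selection copies or negates one fresh bit;
injectivity of `φ` keeps it uniform. -/
theorem ShortArcs.select_compose (hP : ShortArcs P) (κ : ℕ → Coarse) (τ : ℕ → Fin 12) (t : ℕ) :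
    ∃ φ : Bool → Bool, Function.Injective φ ∧
      ∀ β, select P (compose κ τ β) t = φ (β (source P κ t (τ t))) := by
  classical
  rcases hq : chosen P κ t (τ t) with _ | ⟨s, i⟩
  · refine ⟨id, Function.injective_id, fun β => ?_⟩
    rw [select_compose_of_none hq, source, hq]
    rfl
  · obtain ⟨c, hc, -, -, ⟨c', hc', ho⟩, -⟩ := mem_coarseCandidates.1 (mem_of_chosen hq)
    simp only at hc' ho
    -- The sender selects the advertiser of the picked arc exactly when its bit is `o`.
    set o := outSide ((κ s).1, (κ s).2, false, 0)
    refine ⟨fun b => if b = o then !i else i, ?_, fun β => ?_⟩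
    · intro b b'
      cases b <;> cases b' <;> cases o <;> cases i <;> simp
    · rw [select_compose_of_some hq, source, hq]
      simp only [Option.map_some, Option.getD_some]
      refine if_congr ⟨?_, ?_⟩ rfl rfl
      · rintro ⟨c₁, c₁', h1, h1', h⟩
        obtain rfl := Option.some.inj (hc.symm.trans h1)
        obtain rfl := Option.some.inj (hc'.symm.trans h1')
        exact hP.adv_injective hc' (h.trans ho.symm)
      · intro h
        exact ⟨c, c', hc, hc', by rw [h]; exact ho⟩

theorem source_eq_or (κ : ℕ → Coarse) (t : ℕ) (r : Fin 12) :
    source P κ t r = t ∨ ∃ a, PicksWith P (κ (source P κ t r)) a (source P κ t r) t := by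
  rcases hq : chosen P κ t r with _ | ⟨s, i⟩
  · left
    rw [source, hq]
    rfl
  · right
    obtain ⟨c, -, h⟩ := mem_coarseCandidates.1 (mem_of_chosen hq)
    have hs : source P κ t r = s := by
      rw [source, hq]
      rfl
    rw [hs]
    exact ⟨_, h⟩

theorem source_le (κ : ℕ → Coarse) (t : ℕ) (r : Fin 12) : source P κ t r ≤ t := by
  rcases source_eq_or (P := P) κ t r with h | ⟨a, h⟩
  · exact h.le
  · exact h.1.1.le

/-- If a receiver `t` imitates a sender `s` of the same advertiser `a`, then one of them
selects `a`. -/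
theorem ShortArcs.select_of_source_eq (hP : ShortArcs P) {κ : ℕ → Coarse} {τ : ℕ → Fin 12}
    {s t : ℕ} (hst : s ≠ t) (h : source P κ t (τ t) = s) {a : A} {e e' : Bool}
    {c c' : ComboPair A} (hc : P s = some c) (hc' : P t = some c') (he : (c e).adv = a)
    (he' : (c' e').adv = a) {β : ℕ → Bool} (hs : select P (compose κ τ β) s ≠ e) :
    select P (compose κ τ β) t = e' := by
  rcases hq : chosen P κ t (τ t) with _ | ⟨s', i⟩
  · rw [source, hq] at h
    exact absurd h.symm hst
  · rw [source, hq] at h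
    obtain rfl : s' = s := h
    obtain ⟨c₁, hc₁, -, hsend, ⟨c₂, hc₂, ho⟩, -⟩ := mem_coarseCandidates.1 (mem_of_chosen hq)
    simp only [isSender] at hc₂ ho hsend
    obtain rfl := Option.some.inj (hc'.symm.trans hc₁)
    obtain rfl := Option.some.inj (hc.symm.trans hc₂)
    have hns : chosen P κ s' (τ s') = none := if_pos hsend
    rw [select_compose_of_none hns] at hs
    rw [select_compose_of_some hq]
    by_cases hi : i = e'
    · rw [if_neg, hi]
      rintro ⟨c₁, c₂, h1, h2, h3⟩
      obtain rfl := Option.some.inj (hc'.symm.trans h1)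
      obtain rfl := Option.some.inj (hc.symm.trans h2)
      rw [hi, he', ← he] at h3
      exact hs (hP.adv_injective hc h3)
    -- The arc belongs to the other advertiser of both rounds. As `s` does not select `a`, it
    -- selects that one, so `t` turns away from it and selects `a`.
    · have hoe : outSide ((κ s').1, (κ s').2, false, 0) ≠ e := by
        intro hoe
        rw [hoe, he, ← he'] at ho
        exact hi (hP.adv_injective hc' ho).symm
      have hob : β s' = outSide ((κ s').1, (κ s').2, false, 0) := by
        rw [Bool.eq_not.2 hs, Bool.eq_not.2 hoe]
      rw [if_pos ⟨c', c, hc', hc, by rw [hob]; exact ho⟩]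
      exact (Bool.eq_not.2 (Ne.symm hi)).symm

/-- A common source of two rounds lies outside both by assumption, so it is a sender that picked
arcs to both; but it picks only one. -/
theorem source_injOn {κ : ℕ → Coarse} {τ : ℕ → Fin 12} {T : Set ℕ}
    (h : ∀ s ∈ T, ∀ t ∈ T, s ≠ t → source P κ t (τ t) ≠ s) :
    Set.InjOn (fun t => source P κ t (τ t)) T := by
  intro t ht t' ht' heq
  simp only at heq
  by_contra hne
  rcases source_eq_or (P := P) κ t (τ t) with h1 | ⟨a, h1⟩
  · exact h t ht t' ht' hne (heq.symm.trans h1)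
  · rcases source_eq_or (P := P) κ t' (τ t') with h2 | ⟨a', h2⟩
    · exact h t' ht' t ht (Ne.symm hne) (heq.trans h2)
    · rw [← heq] at h2
      exact hne (picksWith_target_unique h1 h2)

/-- If the selections are decided by different fresh bits, they are independent. -/
theorem ShortArcs.bitExp_eq (hP : ShortArcs P) {n : ℕ} (T : Finset ℕ) (hT : ∀ t ∈ T, t < n)
    (e : ℕ → Bool) {κ : ℕ → Coarse} {τ : ℕ → Fin 12}
    (h : Set.InjOn (fun t => source P κ t (τ t)) T) :
    bitExp n (fun β => if ∀ t ∈ T, select P (compose κ τ β) t = e t then 1 else 0) =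
      (1 / 2) ^ T.card := by
  choose φ hφ hsel using hP.select_compose κ τ
  have hprod : (fun β : ℕ → Bool => if ∀ t ∈ T, select P (compose κ τ β) t = e t then (1 : ℝ)
      else 0) = fun β => ∏ t ∈ T, if φ t (β (source P κ t (τ t))) = e t then (1 : ℝ) else 0 := by
    funext β
    simp only [← hsel, Finset.prod_ite_zero, Finset.prod_const_one]
  rw [hprod, bitExp]
  have hw : ∑ _b : Bool, (1 / 2 : ℝ) = 1 := by norm_num
  refine (finExp_prod hw T h (fun t ht => (source_le κ t _).trans_lt (hT t ht))
    (fun t b => if φ t b = e t then (1 : ℝ) else 0)).trans ?_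
  rw [← Finset.prod_const]
  refine Finset.prod_congr rfl fun t _ => ?_
  have hinj := hφ t
  have hne : φ t true ≠ φ t false := fun h => absurd (hinj h) (by decide)
  rw [Fintype.sum_bool]
  rcases h1 : φ t true <;> rcases h2 : φ t false <;> rcases e t <;> simp_all

end SenderReceiver

namespace SenderReceiver

variable {A : Type*} {P : ℕ → Option (ComboPair A)}

/-! ### The probability that an arc is chosen -/

/-- The state of a sender determines the advertiser of its picked arc, so a sender contributes at
most one candidate. -/
theorem ShortArcs.length_coarseCandidates_le (hP : ShortArcs P) (κ : ℕ → Coarse) (t : ℕ) :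
    ((coarseCandidates P κ t).length : ℝ) ≤ rivals (allPicks P t) κ := by
  classical
  unfold rivals
  rw [← Finset.sum_filter, Finset.sum_const, nsmul_one, Nat.cast_le,
    ← List.toFinset_card_of_nodup (nodup_coarseCandidates κ t)]
  refine Finset.card_le_card_of_injOn (fun q => (q.1, κ q.1)) ?_ ?_
  · intro q hq
    obtain ⟨c, hc, h⟩ := mem_coarseCandidates.1 (List.mem_toFinset.1 hq)
    simp only [Finset.coe_filter, Set.mem_ofPred_eq, and_true]
    exact mem_allPicks.2 ⟨c, hc, q.2, h⟩
  · intro q hq q' hq' h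
    obtain ⟨c, hc, -, -, ⟨c₁, hc₁, ho⟩, -⟩ :=
      mem_coarseCandidates.1 (List.mem_toFinset.1 hq)
    obtain ⟨c', hc', -, -, ⟨c₁', hc₁', ho'⟩, -⟩ :=
      mem_coarseCandidates.1 (List.mem_toFinset.1 hq')
    have h1 : q.1 = q'.1 := (Prod.ext_iff.1 h).1
    obtain rfl := Option.some.inj (hc.symm.trans hc')
    rw [← h1] at hc₁' ho'
    obtain rfl := Option.some.inj (hc₁.symm.trans hc₁')
    exact Prod.ext h1 (hP.adv_injective hc (ho.symm.trans ho'))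

theorem source_of_receiver {κ : ℕ → Coarse} {t : ℕ} (ht : (κ t).1 = false) {r : Fin 12}
    (hr : (r : ℕ) % (coarseCandidates P κ t).length < (coarseCandidates P κ t).length) :
    source P κ t r =
      ((coarseCandidates P κ t)[(r : ℕ) % (coarseCandidates P κ t).length]).1 := by
  unfold source chosen
  rw [if_neg (by simp [ht]), List.getElem?_eq_getElem hr]
  rfl

theorem ShortArcs.sum_tie_le (hP : ShortArcs P) {κ : ℕ → Coarse} {s t : ℕ} {x : Coarse}
    (hx : PicksInto P t (s, x)) :
    ∑ r : Fin 12, 1 / 12 * (if source P κ t r = s then (0 : ℝ) else 1) ≤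
      if κ s = x ∧ (κ t).1 = false then rivals ((allPicks P t).erase (s, x)) κ / 2 else 1 := by
  have hone : ∑ r : Fin 12, 1 / 12 * (if source P κ t r = s then (0 : ℝ) else 1) ≤ 1 := by
    refine (Finset.sum_le_sum (g := fun _ => 1 / 12) fun r _ => ?_).trans (by norm_num)
    split_ifs <;> norm_num
  split_ifs with h
  swap
  · exact hone
  obtain ⟨h1, h2⟩ := h
  have hlen := hP.length_coarseCandidates_le κ t
  have herase : rivals (allPicks P t) κ = 1 + rivals ((allPicks P t).erase (s, x)) κ := by
    unfold rivals
    rw [← Finset.add_sum_erase _ _ (mem_allPicks.2 hx), if_pos h1]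
  obtain ⟨c, hc, i, hi⟩ := hx
  have hmem : (s, i) ∈ coarseCandidates P κ t :=
    mem_coarseCandidates.2 ⟨c, hc, by simpa only [h1] using hi⟩
  have hsrc := fun r => source_of_receiver (P := P) (r := r) h2
  rw [herase] at hlen
  -- One candidate is chosen for sure, and one of two is missed with probability 1/2. With three or
  -- more there are at least two rivals, and the bound is at least `1`.
  rcases hC : coarseCandidates P κ t with _ | ⟨q, _ | ⟨q', _ | ⟨q'', l⟩⟩⟩
  · simp [hC] at hmem
  · simp only [hC, List.length_singleton, Nat.mod_one, zero_lt_one, forall_true_left,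
      List.getElem_cons_zero] at hsrc
    rw [hC, List.mem_singleton] at hmem
    subst hmem
    simp only [hsrc, if_true, mul_zero, Finset.sum_const_zero]
    exact div_nonneg (rivals_nonneg _ _) zero_le_two
  · rw [hC] at hlen
    have hhalf : ∑ r : Fin 12, 1 / 12 * (if source P κ t r = s then (0 : ℝ) else 1) ≤ 1 / 2 := by
      simp only [hC, List.length_cons, List.length_nil] at hsrc
      rw [hC, List.mem_cons, List.mem_singleton] at hmem
      have hpar : ∃ b < 2, ∀ r : Fin 12, (r : ℕ) % 2 = b → source P κ t r = s := by
        rcases hmem with rfl | rfl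
        · refine ⟨0, by norm_num, fun r hr => ?_⟩
          rw [hsrc r (Nat.mod_lt _ (by norm_num))]
          simp [hr]
        · refine ⟨1, by norm_num, fun r hr => ?_⟩
          rw [hsrc r (Nat.mod_lt _ (by norm_num))]
          simp [hr]
      obtain ⟨b, hb, hpar⟩ := hpar
      have hle : ∀ r : Fin 12, 1 / 12 * (if source P κ t r = s then (0 : ℝ) else 1) ≤
          1 / 12 * (if (r : ℕ) % 2 = b then (0 : ℝ) else 1) := by
        intro r
        by_cases hr : (r : ℕ) % 2 = b
        · rw [if_pos hr, if_pos (hpar r hr)]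
        · rw [if_neg hr]
          split_ifs <;> norm_num
      refine (Finset.sum_le_sum fun r _ => hle r).trans ?_
      interval_cases b <;> norm_num [Fin.sum_univ_succ]
    simp only [List.length_cons, List.length_nil] at hlen
    push_cast at hlen
    linarith
  · rw [hC] at hlen
    simp only [List.length_cons] at hlen
    push_cast at hlen
    have : (0 : ℝ) ≤ (l.length : ℝ) := Nat.cast_nonneg _
    linarith

theorem ShortArcs.exists_competitors (hP : ShortArcs P) {a : A} {u : ℕ → ℕ} (hu : StrictMono u)
    {m : ℕ} (harc : ∀ j < m, Arc P a (u j) (u (j + 1))) :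
    ∃ (l : ℕ → Coarse) (D : ℕ → Finset (ℕ × Coarse)), (∀ j, (l j).1 = true) ∧
      Competitors u l D ∧ ∀ j < m, PicksInto P (u (j + 1)) (u j, l j) ∧
        D j = (allPicks P (u (j + 1))).erase (u j, l j) := by
  classical
  have hlabel : ∀ j, ∃ x : Coarse, x.1 = true ∧
      (j < m → PicksInto P (u (j + 1)) (u j, x)) := by
    intro j
    by_cases hj : j < m
    · obtain ⟨x, hx, hp⟩ := hP.exists_picksWith (harc j hj)
      obtain ⟨-, y, -, ⟨c, hc, i, hi, -⟩, -⟩ := harc j hj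
      exact ⟨x, hx, fun _ => ⟨c, hc, i, by rw [hi]; exact hp⟩⟩
    · exact ⟨(true, true, true), rfl, fun h => absurd h hj⟩
  choose l hl hpick using hlabel
  -- Beyond the chain, labels are arbitrary sender states and the competitor sets are empty.
  refine ⟨l, fun j => if j < m then (allPicks P (u (j + 1))).erase (u j, l j) else ∅, hl, ?_,
    fun j hj => ⟨hpick j hj, if_pos hj⟩⟩
  have hmem : ∀ {j c}, c ∈ (if j < m then (allPicks P (u (j + 1))).erase (u j, l j) else ∅) →
      j < m ∧ c ≠ (u j, l j) ∧ PicksInto P (u (j + 1)) c := by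
    intro j c hc
    split_ifs at hc with hj
    · obtain ⟨h1, h2⟩ := Finset.mem_erase.1 hc
      exact ⟨hj, h1, mem_allPicks.1 h2⟩
    · simp at hc
  have htarget : ∀ {t t' c}, PicksInto P t c → PicksInto P t' c → t = t' := by
    rintro t t' c ⟨d, -, i, h⟩ ⟨d', -, i', h'⟩
    exact picksWith_target_unique h h'
  constructor
  · intro j
    split_ifs with hj
    · rw [Finset.card_erase_of_mem (mem_allPicks.2 (hpick j hj))]
      have := hP.card_allPicks_le (u (j + 1))
      omega
    · simp
  · intro j c hc
    obtain ⟨-, -, d, -, i, h⟩ := hmem hc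
    exact h.2.1
  · intro j c hc
    obtain ⟨-, -, d, -, i, h⟩ := hmem hc
    exact h.1.1
  · rintro i j c hc rfl
    obtain ⟨hj, hne, hp⟩ := hmem hc
    by_cases hi : i < m
    · have := hu.injective (htarget (hpick i hi) hp)
      obtain rfl : i = j := by omega
      exact hne rfl
    -- A competitor precedes the head of its arc, so it cannot be sent by a node `u i` with `i ≥ m`.
    · obtain ⟨d, -, k, h⟩ := hp
      have h1 : u i < u (j + 1) := h.1.1
      have := hu.lt_iff_lt.1 h1
      omega
  · intro i j c hi hj
    have := hu.injective (htarget (hmem hi).2.2 (hmem hj).2.2)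
    omega

/-- The probability that an advertiser is not selected in any round of a chain. -/
theorem ShortArcs.exp_never_le (hP : ShortArcs P) {a : A} {u : ℕ → ℕ} (hu : StrictMono u)
    {n m : ℕ} (hm : u m < n) (harc : ∀ j < m, Arc P a (u j) (u (j + 1))) (e : ℕ → Bool)
    (he : ∀ j ≤ m, ∃ c, P (u j) = some c ∧ (c (e (u j))).adv = a) :
    (coarseExp n fun κ => tieExp n fun τ => bitExp n fun β =>
      if ∀ j ≤ m, select P (compose κ τ β) (u j) ≠ e (u j) then 1 else 0) ≤
        (1 / 2) ^ (m + 1) * (461 / 486) ^ m := by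
  classical
  obtain ⟨l, D, hl, hD, hpick⟩ := hP.exists_competitors hu harc
  have hbits : ∀ κ τ, (bitExp n fun β =>
      if ∀ j ≤ m, select P (compose κ τ β) (u j) ≠ e (u j) then 1 else 0) ≤ (1 / 2) ^ (m + 1) *
        ∏ j ∈ Finset.range m, if source P κ (u (j + 1)) (τ (u (j + 1))) = u j then 0 else 1 := by
    intro κ τ
    -- The source may be any other node of the chain, through either advertiser; each such case
    -- already forces a selection of `a`.
    by_cases hex : ∃ i ≤ m, ∃ j ≤ m, i ≠ j ∧ source P κ (u j) (τ (u j)) = u i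
    · obtain ⟨i, hi, j, hj, hij, hs⟩ := hex
      obtain ⟨c, hc, hca⟩ := he i hi
      obtain ⟨c', hc', hca'⟩ := he j hj
      have hz : (fun β : ℕ → Bool => if ∀ j ≤ m, select P (compose κ τ β) (u j) ≠ e (u j)
          then (1 : ℝ) else 0) = fun _ => 0 := by
        funext β
        refine if_neg fun hall => hall j hj ?_
        exact hP.select_of_source_eq (fun h => hij (hu.injective h)) hs hc hc' hca hca' (hall i hi)
      rw [hz, bitExp, finExp_zero_fun]
      refine mul_nonneg (by positivity) (Finset.prod_nonneg fun j _ => ?_)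
      split_ifs <;> norm_num
    · push Not at hex
      have hone : (∏ j ∈ Finset.range m,
          if source P κ (u (j + 1)) (τ (u (j + 1))) = u j then (0 : ℝ) else 1) = 1 := by
        refine Finset.prod_eq_one fun j hj => if_neg ?_
        have := Finset.mem_range.1 hj
        exact hex j this.le (j + 1) this (Nat.succ_ne_self j).symm
      have hb := hP.bitExp_eq (n := n) ((Finset.range (m + 1)).image u) (by
        intro t ht
        obtain ⟨j, hj, rfl⟩ := Finset.mem_image.1 ht
        exact (hu.monotone (Nat.lt_succ_iff.1 (Finset.mem_range.1 hj))).trans_lt hm)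
        (fun t => !e t) (κ := κ) (τ := τ) (source_injOn (by
          simp only [Finset.coe_image, Set.mem_image, Finset.coe_range, Set.mem_Iio]
          rintro _ ⟨i, hi, rfl⟩ _ ⟨j, hj, rfl⟩ hij
          exact hex i (by omega) j (by omega) fun h => hij (by rw [h])))
      rw [Finset.card_image_of_injective _ hu.injective, Finset.card_range] at hb
      rw [hone, mul_one, ← hb]
      refine finExp_mono (fun _ => by norm_num) n fun β => le_of_eq (if_congr ?_ rfl rfl)
      simp only [Finset.forall_mem_image, Finset.mem_range, Nat.lt_succ_iff, ne_eq, Bool.eq_not]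
  have hties : ∀ κ, (tieExp n fun τ => bitExp n fun β =>
      if ∀ j ≤ m, select P (compose κ τ β) (u j) ≠ e (u j) then 1 else 0) ≤ (1 / 2) ^ (m + 1) *
        ∏ j ∈ Finset.range m, missFactor u l D j κ := by
    intro κ
    refine (finExp_mono (fun _ => by norm_num) n (hbits κ)).trans ?_
    rw [finExp_const_mul]
    refine mul_le_mul_of_nonneg_left ?_ (by positivity)
    -- The heads are distinct, so given the coarse states their draws are independent.
    have hp := finExp_prod (X := Fin 12) (w := fun _ => 1 / 12) (n := n) (by norm_num)
      (Finset.range m) (v := fun j => u (j + 1))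
      (fun i _ j _ h => Nat.succ_injective (hu.injective h))
      (fun j hj => (hu.monotone (Finset.mem_range.1 hj)).trans_lt hm)
      (fun j r => if source P κ (u (j + 1)) r = u j then (0 : ℝ) else 1)
    refine hp.le.trans (Finset.prod_le_prod (fun j _ => Finset.sum_nonneg fun r _ => ?_)
      fun j hj => ?_)
    · split_ifs <;> norm_num
    · obtain ⟨h1, h2⟩ := hpick j (Finset.mem_range.1 hj)
      unfold missFactor
      rw [h2]
      exact hP.sum_tie_le h1
  refine (finExp_mono coarseWeight_nonneg n hties).trans ?_
  rw [finExp_const_mul]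
  exact mul_le_mul_of_nonneg_left (coarseExp_missProd_le hl hu hm hD) (by positivity)

/-! ### The guarantees of the algorithm -/

theorem select_congr_of_lt {t n : ℕ} (ht : t < n) {ω ω' : ℕ → Seed} (h : ∀ i < n, ω i = ω' i) :
    select P ω t = select P ω' t :=
  select_online P P ω ω' t (fun _ _ => rfl) fun s hs => h s (hs.trans_lt ht)

theorem ShortArcs.prob_select (hP : ShortArcs P) {p : unitInterval} (hp : (p : ℝ) = 4 / 9) (t : ℕ)
    (s : Bool) :
    (Measure.infinitePi fun _ : ℕ => law p).real {ω | select P ω t = s} = 1 / 2 := by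
  classical
  have hmeas : MeasurableSet {ω : ℕ → Seed | select P ω t = s} :=
    measurable_select P t (measurableSet_singleton s)
  rw [← integral_indicator_one hmeas, integral_law_eq (t + 1) _ hp]
  · have h : ∀ κ τ, (bitExp (t + 1) fun β => {ω : ℕ → Seed | select P ω t = s}.indicator 1
        (compose κ τ β)) = 1 / 2 := by
      intro κ τ
      have := hP.bitExp_eq (n := t + 1) {t} (by simp) (fun _ => s) (κ := κ) (τ := τ) (by simp)
      simpa [Set.indicator_apply] using this
    simp only [h, coarseExp, tieExp]
    rw [finExp_const sum_coarseWeight, finExp_const (by norm_num)]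
  · intro ω ω' h
    simp only [Set.indicator_apply, Set.mem_ofPred_eq, Pi.one_apply,
      select_congr_of_lt (Nat.lt_succ_self t) h]

theorem ShortArcs.prob_never_le (hP : ShortArcs P) {p : unitInterval} (hp : (p : ℝ) = 4 / 9)
    {a : A} {u : ℕ → ℕ} (hu : StrictMono u) {n m : ℕ} (hm : u m < n)
    (harc : ∀ j < m, Arc P a (u j) (u (j + 1))) (e : ℕ → Bool)
    (he : ∀ j ≤ m, ∃ c, P (u j) = some c ∧ (c (e (u j))).adv = a) :
    MeasurableSet {ω | ∀ j ≤ m, select P ω (u j) ≠ e (u j)} ∧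
      (Measure.infinitePi fun _ : ℕ => law p).real {ω | ∀ j ≤ m, select P ω (u j) ≠ e (u j)} ≤
        (1 / 2) ^ (m + 1) * (461 / 486) ^ m := by
  classical
  have hmeas : MeasurableSet {ω : ℕ → Seed | ∀ j ≤ m, select P ω (u j) ≠ e (u j)} := by
    simp only [Set.ofPred_forall]
    refine MeasurableSet.iInter fun j => MeasurableSet.iInter fun _ => ?_
    exact measurable_select P (u j) (measurableSet_singleton (e (u j))).compl
  refine ⟨hmeas, ?_⟩
  rw [← integral_indicator_one hmeas, integral_law_eq n _ hp]
  · refine le_trans (le_of_eq ?_) (hP.exp_never_le hu hm harc e he)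
    simp only [Set.indicator_apply, Set.mem_ofPred_eq, Pi.one_apply]
  · intro ω ω' h
    simp only [Set.indicator_apply, Set.mem_ofPred_eq]
    refine if_congr (forall_congr' fun j => forall_congr' fun hj => ?_) rfl rfl
    rw [select_congr_of_lt ((hu.monotone hj).trans_lt hm) h]

/-- The rounds in which a point is semi-assigned are the beginning of a chain of arcs. -/
theorem exists_chain (P : ℕ → Option (ComboPair A)) (a : A) (y : ℝ) (n : ℕ) :
    ∃ u : ℕ → ℕ, StrictMono u ∧ ∀ k, (∃ S : Finset ℕ, S.card = k ∧
      ∀ t, t ∈ S ↔ t < n ∧ SemiAssigned P t a y) → (∀ j < k, u j < n ∧ SemiAssigned P (u j) a y) ∧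
        ∀ j, j + 1 < k → Arc P a (u j) (u (j + 1)) := by
  classical
  -- All rounds from `n` on are added, which makes the enumeration infinite and `u` strictly
  -- monotone everywhere.
  let q : ℕ → Prop := fun t => n ≤ t ∨ SemiAssigned P t a y
  have hq : (Set.ofPred q).Infinite := Set.infinite_of_forall_exists_gt fun b =>
    ⟨max n (b + 1), Or.inl (le_max_left _ _), by simp⟩
  have hmono : StrictMono (Nat.nth q) := Nat.nth_strictMono hq
  refine ⟨Nat.nth q, hmono, ?_⟩
  rintro k ⟨S, hk, hS⟩
  have hcount : Nat.count q n = k := by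
    rw [Nat.count_eq_card_filter_range, ← hk]
    congr 1
    ext t
    rw [hS, Finset.mem_filter, Finset.mem_range]
    refine and_congr_right fun ht => ⟨fun h => h.resolve_left (by omega), Or.inr⟩
  have h1 : ∀ j < k, Nat.nth q j < n ∧ SemiAssigned P (Nat.nth q j) a y := by
    intro j hj
    have hlt : Nat.nth q j < n := Nat.nth_lt_of_lt_count (hcount ▸ hj)
    exact ⟨hlt, (Nat.nth_mem_of_infinite hq j).resolve_left (by omega)⟩
  refine ⟨h1, fun j hj => ⟨hmono (Nat.lt_succ_self j), y, (h1 j (by omega)).2, (h1 _ hj).2, ?_⟩⟩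
  intro r hr hr' h
  have hqr : q r := Or.inr h
  rw [← Nat.nth_count hqr] at hr hr'
  have := hmono.lt_iff_lt.1 hr
  have := hmono.lt_iff_lt.1 hr'
  omega

end SenderReceiver

/-! ### The guarantee for large bids. -/

theorem shortArcs_panPairs {A : Type*} {B : A → ℝ} {I : ℕ → Impression A} (hB : ∀ a, 0 < B a)
    (hV : ValidInstance B I) (hL : LargeBids B I) : SenderReceiver.ShortArcs (panPairs B I) where
  distinct t c hc := by
    unfold panPairs at hc
    rcases hd : (I t).decision with b | p
    · simp [hd] at hc
    · rw [hd] at hc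
      obtain rfl := Option.some.inj hc
      exact hV.distinct t p hd
  between _ _ _ _ _ _ _ := not_semiAssigned_twice_of_arc hB hV hL

theorem mainTheorem3 {A : Type*} (B : A → ℝ) (hB : ∀ a, 0 < B a) :
    IsPanOCS B (LargeBids B) 0.05144
      (senderReceiver A ⟨4 / 9, by norm_num, by norm_num⟩) := by
  classical
  refine ⟨by norm_num, by norm_num, fun I hV hL => ?_⟩
  have hP := shortArcs_panPairs hB hV hL
  refine ⟨fun t _ s => hP.prob_select rfl t s, fun n a y hy => ?_⟩
  unfold semiCount
  split_ifs with hdet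
  · obtain ⟨t, ht, hd⟩ := hdet
    have huniv : assignedEvent B (senderReceiver A ⟨4 / 9, by norm_num, by norm_num⟩) I n a y =
        Set.univ := Set.eq_univ_of_forall fun ω => ⟨t, ht, Or.inl hd⟩
    have : IsProbabilityMeasure (senderReceiver A ⟨4 / 9, by norm_num, by norm_num⟩).prob := by
      unfold OnlineSelector.prob
      infer_instance
    rw [huniv, probReal_univ]
    exact le_rfl
  · obtain ⟨u, hu, hchain⟩ := SenderReceiver.exists_chain (panPairs B I) a y n
    obtain ⟨h1, harc⟩ := hchain _ ⟨(Finset.range n).filter fun t =>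
      SemiAssigned (panPairs B I) t a y, rfl, fun t => by simp⟩
    generalize ((Finset.range n).filter fun t => SemiAssigned (panPairs B I) t a y).card = k at *
    change 1 - (1 / 2) ^ k * (1 - 0.05144) ^ (k - 1) ≤ _
    rcases k with _ | m
    · norm_num
    have hside : ∀ t, ∃ s : Bool, SemiAssigned (panPairs B I) t a y →
        ∃ c, panPairs B I t = some c ∧ (c s).adv = a ∧ y ∈ (c s).pts := by
      intro t
      by_cases h : SemiAssigned (panPairs B I) t a y
      · obtain ⟨c, hc, s, hs⟩ := h
        exact ⟨s, fun _ => ⟨c, hc, hs⟩⟩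
      · exact ⟨true, fun h' => absurd h' h⟩
    choose e he using hside
    obtain ⟨hmeas, hnever⟩ := hP.prob_never_le (p := ⟨4 / 9, by norm_num, by norm_num⟩) rfl hu
      (h1 m (Nat.lt_succ_self m)).1 (fun j hj => harc j (by omega)) e fun j hj => by
        obtain ⟨c, hc, ha, -⟩ := he (u j) (h1 j (by omega)).2
        exact ⟨c, hc, ha⟩
    have hsub : {ω | ∀ j ≤ m, SenderReceiver.select (panPairs B I) ω (u j) ≠ e (u j)}ᶜ ⊆
        assignedEvent B (senderReceiver A ⟨4 / 9, by norm_num, by norm_num⟩) I n a y := by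
      intro ω hω
      simp only [Set.mem_compl_iff, Set.mem_ofPred_eq, not_forall, not_not] at hω
      obtain ⟨j, hj, hsel⟩ := hω
      obtain ⟨hjn, hsemi⟩ := h1 j (by omega)
      obtain ⟨c, hc, ha, hyc⟩ := he (u j) hsemi
      refine ⟨u j, hjn, Or.inr ⟨c, hc, ?_⟩⟩
      change (c (SenderReceiver.select (panPairs B I) ω (u j))).adv = a ∧
        y ∈ (c (SenderReceiver.select (panPairs B I) ω (u j))).pts
      rw [hsel]
      exact ⟨ha, hyc⟩
    -- Here 1 - 461/486 = 25/486 = 0.051440..., slightly more than 0.05144.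
    have hpow : (461 / 486 : ℝ) ^ m ≤ (1 - 0.05144) ^ m :=
      pow_le_pow_left₀ (by norm_num) (by norm_num) m
    have hle : (1 / 2 : ℝ) ^ (m + 1) * (461 / 486) ^ m ≤ (1 / 2) ^ (m + 1) * (1 - 0.05144) ^ m :=
      mul_le_mul_of_nonneg_left hpow (by positivity)
    rw [Nat.add_sub_cancel]
    refine le_trans ?_ (measureReal_mono (μ := Measure.infinitePi fun _ : ℕ =>
      SenderReceiver.law ⟨4 / 9, by norm_num, by norm_num⟩) hsub)
    rw [probReal_compl_eq_one_sub hmeas]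
    linarith
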